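/- Let $d,m\ge 1$, let $\mu:\mathbb R^d\to\mathbb R^d$, let $\sigma:\mathbb R^d\to\mathbb R^{d\times m}$ be measurable, put $a=\sigma\sigma^\top$, and let $\lambda:\mathbb R^d\to\mathbb R$. Assume that $\mu$ is $C^1$ and bounded with bounded first derivatives, that the entries $a^{i,j}$ are $C^2$ and bounded with bounded derivatives of orders one and two, that there are constants $0<a_1\le a_2$ with $a_1|v|^2\le v^\top a(y)v\le a_2|v|^2$ for all $y,v\in\mathbb R^d$, and that $\lambda$ is $C^1$ with $0<\lambda_1\le\lambda(y)\le\lambda_2$ for all $y$. Fix $\sigma_A>0$, $T>0$, $\epsilon>0$ and $\gamma<1$. Let $W$ be a standard $m$-dimensional and $\bar W$ a standard one-dimensional Brownian motion, and let $\xi_1,\xi_2,\dots$ be i.i.d. with density $\psi(t)=\frac{1-\gamma}{t^{\gamma}(T+\epsilon)^{1-\gamma}}$ on $(0,T+\epsilon]$, where $W$, $\bar W$ and $(\xi_k)_k$ are independent. Put $\Psi(t)=\int_t^\infty\psi(s)\,ds$, $\tau_k=\xi_1+\dots+\xi_k$ (so $\tau_0=0$), and let $N_t$ be the index $n$ with $\tau_n\le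 t<\tau_{n+1}$. For $x\in\mathbb R^d$ let $Z^\pi=(Y^\pi,\bar A^\pi)$ be the Euler process on the grid $(\tau_k)_k$ with $Z^\pi_0=(x,0)$, that is, for $\tau_k\le t\le\tau_{k+1}$, $$Y^\pi_t=Y^\pi_{\tau_k}+\mu(Y^\pi_{\tau_k})(t-\tau_k)+\sigma(Y^\pi_{\tau_k})(W_t-W_{\tau_k}),\qquad \bar A^\pi_t=\bar A^\pi_{\tau_k}+\lambda(Y^\pi_{\tau_k})(t-\tau_k)+\sigma_A(\bar W_t-\bar W_{\tau_k}).$$ For $y_1,y_2\in\mathbb R^d$ and $t>0$ put $w=(t\,a(y_1))^{-1}(y_2-y_1-t\mu(y_1))$, $h^i=-w_i$, $h^{i,j}=w_iw_j-\big((t\,a(y_1))^{-1}\big)_{ij}$, and $$\vartheta_t(y_1,y_2)=\tfrac12\sum_{i,j}\Big(\partial^2_{i,j}a^{i,j}(y_2)+\partial_ja^{i,j}(y_2)h^i+\partial_ia^{i,j}(y_2)h^j+(a^{i,j}(y_2)-a^{i,j}(y_1))h^{i,j}\Big)-\sum_i\Big(\partial_i\mu^i(y_2)+(\mu^i(y_2)-\mu^i(y_1))h^i\Big).$$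 For $z_k=(y_k,\bar a_k)\in\mathbb R^{d}\times\mathbb R$ put $$\theta_t(z_1,z_2)=\vartheta_t(y_1,y_2)+(\lambda(y_2)-\lambda(y_1))\,\frac{\bar a_2-\bar a_1-\lambda(y_1)t}{t\sigma_A^2},\qquad \Theta_2(Z^\pi,T)=\frac1{\Psi(T-\tau_{N_T})}\prod_{k=1}^{N_T}\frac{\theta_{\tau_k-\tau_{k-1}}(Z^\pi_{\tau_{k-1}},Z^\pi_{\tau_k})}{\psi(\tau_k-\tau_{k-1})}.$$ Let $S_n=\{(s_1,\dots,s_n): 0=s_0<s_1<\dots<s_n<T\}$ and $$p_n(s_1,\dots,s_n)=\Big(1-\Big(\tfrac{T-s_n}{T+\epsilon}\Big)^{1-\gamma}\Big)\Big(\tfrac{1-\gamma}{(T+\epsilon)^{1-\gamma}}\Big)^n\prod_{i=0}^{n-1}\frac1{(s_{i+1}-s_i)^\gamma}.$$ For $p,c_1,C_T>0$ define $M(T,p)\in(0,\infty]$ by $$M(T,p)=C_T\exp\big(((2c_1^2a_2d+\sigma_A^2)p^2+\lambda_2p)T\big)\sum_{n=0}^\infty\int_{S_n}\frac1{p_n(s_1,\dots,s_n)^{p-1}}\prod_{j=1}^n(s_j-s_{j-1})^{-p/2}\,ds.$$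 1. For all $p>0$ and $c_2>0$ there is a constant $C_T>0$, depending on $p$, $c_2$, $T$, $\epsilon$, $\gamma$, $\sigma_A$, $\mu$, $\sigma$, $\lambda$ and the bounds on them, but neither on $c_1$ nor on $x$, such that for all $c_1>0$ and all $x\in\mathbb R^d$ $$\mathbb E\Big[\big|e^{-\bar A^\pi_T}e^{c_1\|Y^\pi_T\|_1+c_2}\,\Theta_2(Z^\pi,T)\big|^p\Big]\le M(T,p)\prod_{i=1}^d\cosh(c_1p\,x^{(i)}).$$ 2. If $p(1/2-\gamma)<1-\gamma$, then $M(T,p)<\infty$. 3. Consequently, if $2(1/2-\gamma)<1-\gamma$ (that is, $\gamma>0$), then for all $c_1,c_2>0$ and every measurable $f:\mathbb R^d\to\mathbb R$ with $|f(y)|\le e^{c_1\|y\|_1+c_2}$ there is a constant $M_T$ such that for all $x\in\mathbb R^d$ $$\mathbb E\Big[\big(e^{-\bar A^\pi_T}f(Y^\pi_T)\,\Theta_2(Z^\pi,T)\big)^2\Big]<M_T\exp(2c_1\|x\|_1).$$ -/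

import Mathlib

open MeasureTheory ProbabilityTheory
open scoped NNReal ENNReal Matrix

universe u

noncomputable section

namespace Parametrix

/-- A map is of class `C^k_b`: it is `k` times continuously differentiable, and it is bounded
together with its derivatives up to order `k`. -/
def IsCkb {E F : Type*} [NormedAddCommGroup E] [NormedSpace ℝ E] [NormedAddCommGroup F]
    [NormedSpace ℝ F] (k : ℕ) (g : E → F) : Prop :=
  ContDiff ℝ k g ∧ ∀ j ≤ k, ∃ K : ℝ, ∀ y, ‖iteratedFDeriv ℝ j g y‖ ≤ K

/-- The `ℓ¹` norm on `ℝ^d`. -/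
def l1norm {d : ℕ} (y : Fin d → ℝ) : ℝ := ∑ i, |y i|

/-- The partial derivative `∂_i g (y)`. -/
def partialDeriv {d : ℕ} (i : Fin d) (g : (Fin d → ℝ) → ℝ) (y : Fin d → ℝ) : ℝ :=
  fderiv ℝ g y (Pi.single i 1)

/-- The coefficients of the diffusion `dY = mu(Y) dt + sigma(Y) dW`,
`dA = lam(Y) dt + sigmaA dWbar` on `ℝ^d × ℝ`. -/
structure Model (d m : ℕ) where
  mu : (Fin d → ℝ) → (Fin d → ℝ)
  sigma : (Fin d → ℝ) → Matrix (Fin d) (Fin m) ℝ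
  lam : (Fin d → ℝ) → ℝ
  sigmaA : ℝ

namespace Model

variable {d m : ℕ} (S : Model d m)

/-- The diffusion matrix `a = sigma sigmaᵀ`. -/
def a (y : Fin d → ℝ) : Matrix (Fin d) (Fin d) ℝ := S.sigma y * (S.sigma y)ᵀ

/-- The assumptions on the coefficients, with ellipticity bounds `a₁`, `a₂` and bounds
`lam₁`, `lam₂` for the intensity. -/
structure IsAdmissible (a₁ a₂ lam₁ lam₂ : ℝ) : Prop where
  mu_reg : IsCkb 1 S.mu
  sigma_meas : ∀ i k, Measurable fun y => S.sigma y i k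
  a_reg : ∀ i j, IsCkb 2 fun y => S.a y i j
  a₁_pos : 0 < a₁
  a₁_le_a₂ : a₁ ≤ a₂
  elliptic_lower : ∀ y v, a₁ * ∑ i, v i ^ 2 ≤ v ⬝ᵥ (S.a y *ᵥ v)
  elliptic_upper : ∀ y v, v ⬝ᵥ (S.a y *ᵥ v) ≤ a₂ * ∑ i, v i ^ 2
  lam_reg : ContDiff ℝ 1 S.lam
  lam₁_pos : 0 < lam₁
  lam_lower : ∀ y, lam₁ ≤ S.lam y
  lam_upper : ∀ y, S.lam y ≤ lam₂
  sigmaA_pos : 0 < S.sigmaA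

/-- First order Hermite polynomial `H^i_M(x) = -(M⁻¹ x)_i`. -/
def hermite1 (M : Matrix (Fin d) (Fin d) ℝ) (i : Fin d) (x : Fin d → ℝ) : ℝ :=
  -((M⁻¹ *ᵥ x) i)

/-- Second order Hermite polynomial `H^{ij}_M(x) = (M⁻¹ x)_i (M⁻¹ x)_j - (M⁻¹)_{ij}`. -/
def hermite2 (M : Matrix (Fin d) (Fin d) ℝ) (i j : Fin d) (x : Fin d → ℝ) : ℝ :=
  (M⁻¹ *ᵥ x) i * (M⁻¹ *ᵥ x) j - M⁻¹ i j

/-- `h^i_t(y₁, y₂)`. -/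
def h1 (t : ℝ) (y₁ y₂ : Fin d → ℝ) (i : Fin d) : ℝ :=
  hermite1 (t • S.a y₁) i (y₂ - y₁ - t • S.mu y₁)

/-- `h^{ij}_t(y₁, y₂)`. -/
def h2 (t : ℝ) (y₁ y₂ : Fin d → ℝ) (i j : Fin d) : ℝ :=
  hermite2 (t • S.a y₁) i j (y₂ - y₁ - t • S.mu y₁)

/-- The second order part `ϑ^{ij}_t(y₁, y₂)` of the parametrix weight. -/
def varthetaIJ (t : ℝ) (y₁ y₂ : Fin d → ℝ) (i j : Fin d) : ℝ :=
  partialDeriv i (partialDeriv j fun y => S.a y i j) y₂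
    + partialDeriv j (fun y => S.a y i j) y₂ * S.h1 t y₁ y₂ i
    + partialDeriv i (fun y => S.a y i j) y₂ * S.h1 t y₁ y₂ j
    + (S.a y₂ i j - S.a y₁ i j) * S.h2 t y₁ y₂ i j

/-- The first order part `ρ^i_t(y₁, y₂)` of the parametrix weight. -/
def rhoI (t : ℝ) (y₁ y₂ : Fin d → ℝ) (i : Fin d) : ℝ :=
  partialDeriv i (fun y => S.mu y i) y₂ + (S.mu y₂ i - S.mu y₁ i) * S.h1 t y₁ y₂ i

/-- The parametrix weight `ϑ_t(y₁, y₂)` of the diffusion `Y`. -/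
def vartheta (t : ℝ) (y₁ y₂ : Fin d → ℝ) : ℝ :=
  (1 / 2) * ∑ i, ∑ j, S.varthetaIJ t y₁ y₂ i j - ∑ i, S.rhoI t y₁ y₂ i

/-- The parametrix weight `θ_t(z₁, z₂)` of the augmented diffusion, `z = (y, a)`. -/
def theta (t : ℝ) (z₁ z₂ : (Fin d → ℝ) × ℝ) : ℝ :=
  S.vartheta t z₁.1 z₂.1
    + (S.lam z₂.1 - S.lam z₁.1) * ((z₂.2 - z₁.2 - S.lam z₁.1 * t) / (t * S.sigmaA ^ 2))

/-- One Euler step of length `t` from `z = (y, a)`, with Brownian increments `w` and `wb`. -/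
def eulerStep (z : (Fin d → ℝ) × ℝ) (t : ℝ) (w : Fin m → ℝ) (wb : ℝ) : (Fin d → ℝ) × ℝ :=
  (z.1 + t • S.mu z.1 + S.sigma z.1 *ᵥ w, z.2 + S.lam z.1 * t + S.sigmaA * wb)

end Model

/-- The parameters of the random grid: horizon `T`, and interarrival times on `[0, T + ε]` with
a Beta-type density of parameter `γ`. -/
structure Grid where
  T : ℝ
  ε : ℝ
  γ : ℝ

namespace Grid

variable (G : Grid)

structure IsValid : Prop where
  T_pos : 0 < G.T
  ε_pos : 0 < G.ε
  γ_lt_one : G.γ < 1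

/-- The density `ψ` of the interarrival times. -/
def psi (t : ℝ) : ℝ :=
  if 0 < t ∧ t ≤ G.T + G.ε then (1 - G.γ) / (t ^ G.γ * (G.T + G.ε) ^ (1 - G.γ)) else 0

/-- The survival function `Ψ(t) = ∫_t^∞ ψ(s) ds`. -/
def survival (t : ℝ) : ℝ := ∫ s in Set.Ioi t, G.psi s

/-- The law of the interarrival times. -/
def arrivalLaw : Measure ℝ := volume.withDensity fun t => ENNReal.ofReal (G.psi t)

/-- `(s_0, s_1, …, s_n)` with `s_0 = 0`, from `(s_1, …, s_n)`. -/
def pts {n : ℕ} (s : Fin n → ℝ) : Fin (n + 1) → ℝ := Fin.cons 0 s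

/-- `s_{j+1} - s_j`, for `j = 0, …, n - 1`. -/
def gap {n : ℕ} (s : Fin n → ℝ) (j : Fin n) : ℝ := pts s j.succ - pts s j.castSucc

/-- The set `S_n` of all `(s_1, …, s_n)` with `0 = s_0 < s_1 < ⋯ < s_n < T`. -/
def simplex (n : ℕ) : Set (Fin n → ℝ) :=
  {s | (∀ j : Fin n, pts s j.castSucc < pts s j.succ) ∧ pts s (Fin.last n) < G.T}

/-- The density `p_n(s_1, …, s_n)` of the grid points on the event of exactly `n` arrivals. -/
def pdens {n : ℕ} (s : Fin n → ℝ) : ℝ :=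
  (1 - ((G.T - pts s (Fin.last n)) / (G.T + G.ε)) ^ (1 - G.γ))
    * ((1 - G.γ) / (G.T + G.ε) ^ (1 - G.γ)) ^ n * ∏ j, 1 / (gap s j) ^ G.γ

/-- `∑_n ∫_{S_n} p_n(s)^{-(p-1)} ∏_j (s_j - s_{j-1})^{-p/2} ds`. -/
def gridSum (p : ℝ) : ℝ≥0∞ :=
  ∑' n : ℕ, ∫⁻ s in G.simplex n,
    ENNReal.ofReal (1 / (G.pdens s) ^ (p - 1) * ∏ j, (gap s j) ^ (-p / 2))

end Grid

/-- The constant `M(T, p)` of the moment bound. -/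
def momentConst {d m : ℕ} (S : Model d m) (G : Grid) (a₂ lam₂ C c₁ p : ℝ) : ℝ≥0∞ :=
  ENNReal.ofReal
      (C * Real.exp (((2 * c₁ ^ 2 * a₂ * d + S.sigmaA ^ 2) * p ^ 2 + lam₂ * p) * G.T))
    * G.gridSum p

/-- The random inputs of the scheme: the components of `W`, the Brownian motion `Wbar`, and the
interarrival times `xi 0, xi 1, …`. -/
structure Inputs (m : ℕ) (Ω : Type u) where
  W : Fin m → ℝ≥0 → Ω → ℝ
  Wbar : ℝ≥0 → Ω → ℝ
  xi : ℕ → Ω → ℝ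

namespace Inputs

variable {d m : ℕ} {Ω : Type u} (I : Inputs m Ω)

/-- `W` is an `m`-dimensional and `Wbar` a one-dimensional standard Brownian motion, the
interarrival times are i.i.d. with the given density, and the three are independent. -/
structure HasStandardLaw [MeasurableSpace Ω] (G : Grid) (P : Measure Ω) : Prop where
  W_meas : ∀ i t, Measurable (I.W i t)
  Wbar_meas : ∀ t, Measurable (I.Wbar t)
  xi_meas : ∀ k, Measurable (I.xi k)
  W_brownian : ∀ i, IsBrownianReal (I.W i) P
  W_indep : iIndepFun (fun i ω t => I.W i t ω) P
  Wbar_brownian : IsBrownianReal I.Wbar P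
  W_indep_Wbar : IndepFun (fun ω i t => I.W i t ω) (fun ω t => I.Wbar t ω) P
  xi_law : ∀ k, P.map (I.xi k) = G.arrivalLaw
  xi_indep : iIndepFun I.xi P
  xi_indep_W : IndepFun (fun ω k => I.xi k ω)
    (fun ω => ((fun i t => I.W i t ω : Fin m → ℝ≥0 → ℝ), (fun t => I.Wbar t ω : ℝ≥0 → ℝ))) P

/-- The arrival times `τ_k`, with `τ_0 = 0`. -/
def tau (k : ℕ) (ω : Ω) : ℝ := ∑ j ∈ Finset.range k, I.xi j ω

/-- The counting process `N_t`: the index of the last arrival not after `t`. -/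
def count (t : ℝ) (ω : Ω) : ℕ := sInf {n : ℕ | t < I.tau (n + 1) ω}

/-- The Euler step from the state `z` at time `s` to time `t`. -/
def move (S : Model d m) (z : (Fin d → ℝ) × ℝ) (s t : ℝ) (ω : Ω) : (Fin d → ℝ) × ℝ :=
  S.eulerStep z (t - s) (fun i => I.W i t.toNNReal ω - I.W i s.toNNReal ω)
    (I.Wbar t.toNNReal ω - I.Wbar s.toNNReal ω)

/-- The Euler process at the grid times, `Z^π_{τ_k}`, started at `(x, 0)`. -/
def eulerGrid (S : Model d m) (x : Fin d → ℝ) : ℕ → Ω → (Fin d → ℝ) × ℝ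
  | 0, _ => (x, 0)
  | k + 1, ω => I.move S (eulerGrid S x k ω) (I.tau k ω) (I.tau (k + 1) ω) ω

/-- The Euler process `Z^π_t = (Y^π_t, A^π_t)`, started at `(x, 0)`. -/
def euler (S : Model d m) (x : Fin d → ℝ) (t : ℝ) (ω : Ω) : (Fin d → ℝ) × ℝ :=
  I.move S (I.eulerGrid S x (I.count t ω) ω) (I.tau (I.count t ω) ω) t ω

/-- The correction functional `Θ₂(Z^π, T)`. -/
def Theta2 (S : Model d m) (G : Grid) (x : Fin d → ℝ) (ω : Ω) : ℝ :=
  1 / G.survival (G.T - I.tau (I.count G.T ω) ω)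
    * ∏ k ∈ Finset.range (I.count G.T ω),
        S.theta (I.tau (k + 1) ω - I.tau k ω) (I.eulerGrid S x k ω) (I.eulerGrid S x (k + 1) ω)
          / G.psi (I.tau (k + 1) ω - I.tau k ω)

end Inputs

/-- The `p`-th absolute moment `E[|e^{-A^π_T} f(Y^π_T) Θ₂(Z^π, T)|^p]`, with values in `[0, ∞]`. -/
def moment {d m : ℕ} {Ω : Type u} [MeasurableSpace Ω] (P : Measure Ω) (I : Inputs m Ω)
    (S : Model d m) (G : Grid) (x : Fin d → ℝ) (f : (Fin d → ℝ) → ℝ) (p : ℝ) : ℝ≥0∞ :=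
  ∫⁻ ω, ENNReal.ofReal
    (|Real.exp (-(I.euler S x G.T ω).2) * f (I.euler S x G.T ω).1 * I.Theta2 S G x ω| ^ p) ∂P

end Parametrix

end

/-! The weight θ contains second Hermite polynomials of order 1/t, but they multiply a(y₂) - a(y₁),
which is of order √t along an Euler step. With N the size of the Brownian increment divided by √t, θ
is at most a constant times (1 + N)³/√t (`exists_abs_theta_le`), so |θ|^p ≤ C t^(-p/2) e^N. The
payoff e^(p c₁‖Y‖₁) is at most the sum of e^(η·Y) over the 2^d vectors η with entries ±p c₁. The
integrand is thus dominated by a product of t^(-p/2)/ψ(t)^p over the waiting times, times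
exponentials that factor over the steps (`integrand_le`). By Gaussian scaling e^N costs a constant
factor K per step, and the rest grows exponentially in time, so that for a fixed grid with n
arrivals the expectation is at most K^(n+1) e^(η·x) e^(rate·T) (`lintegral_chainWeight_le`). Summing
over the signs turns e^(η·x) into 2^d ∏ cosh.

What remains is an expectation over the waiting times. One arrival contributes t^(α-1) up to a
constant, where α = `gapExponent`, and the hypothesis of part 2 says α > 0. Since the gaps sum to at
most T, the factor e^(LT) ∏ e^(-L gap) ≥ 1 may be inserted and the constraint dropped. The gaps then
decouple, each integral is Γ(α) L^(-α), and a large L beats every constant per step, leaving a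
geometric series. The same device proves part 2.

The bound of part 1 is not obtained term by term. If α ≤ 0, the term n = 1 makes M infinite. If α >
0, the series over the waiting times is at most a constant B, the term n = 0 keeps the sum in M
above some g > 0, and B/g enters C. Only the growth rate involves c₁; its linear part is absorbed by
the factor 2 in M (`rate_le`), so C is free of c₁. Part 3 is the case p = 2 with cosh u ≤ e^|u|. -/

noncomputable section

namespace Parametrix

/-! ### Bounds for the coefficients -/

section Ckb

variable {d : ℕ} {F : Type*} [NormedAddCommGroup F] [NormedSpace ℝ F]

lemma IsCkb.exists_bound {E : Type*} [NormedAddCommGroup E] [NormedSpace ℝ E] {k : ℕ} {g : E → F}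
    (h : IsCkb k g) : ∃ K : ℝ, 0 ≤ K ∧ ∀ y, ‖g y‖ ≤ K := by
  obtain ⟨K, hK⟩ := h.2 0 (Nat.zero_le _)
  exact ⟨K, (norm_nonneg _).trans (hK 0), fun y => by simpa using hK y⟩

lemma IsCkb.exists_fderiv_bound {E : Type*} [NormedAddCommGroup E] [NormedSpace ℝ E] {k : ℕ}
    {g : E → F} (h : IsCkb k g) (hk : 1 ≤ k) : ∃ K : ℝ, 0 ≤ K ∧ ∀ y, ‖fderiv ℝ g y‖ ≤ K := by
  obtain ⟨K, hK⟩ := h.2 1 hk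
  exact ⟨K, (norm_nonneg _).trans (hK 0), fun y => by
    simpa [norm_iteratedFDeriv_one] using hK y⟩

lemma IsCkb.differentiable {E : Type*} [NormedAddCommGroup E] [NormedSpace ℝ E] {k : ℕ}
    {g : E → F} (h : IsCkb k g) (hk : 1 ≤ k) : Differentiable ℝ g :=
  h.1.differentiable (by exact_mod_cast (Nat.one_le_iff_ne_zero.mp hk))

lemma IsCkb.exists_lipschitz {E : Type*} [NormedAddCommGroup E] [NormedSpace ℝ E] {k : ℕ}
    {g : E → F} (h : IsCkb k g) (hk : 1 ≤ k) :
    ∃ K : ℝ, 0 ≤ K ∧ ∀ y₁ y₂, ‖g y₂ - g y₁‖ ≤ K * ‖y₂ - y₁‖ := by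
  obtain ⟨K, hK0, hK⟩ := h.exists_fderiv_bound hk
  exact ⟨K, hK0, fun y₁ y₂ => convex_univ.norm_image_sub_le_of_norm_fderiv_le
    (fun x _ => (h.differentiable hk) x) (fun x _ => hK x) (Set.mem_univ _) (Set.mem_univ _)⟩

lemma norm_single_one_le (i : Fin d) : ‖(Pi.single i 1 : Fin d → ℝ)‖ ≤ 1 := by
  rw [pi_norm_le_iff_of_nonneg zero_le_one]
  intro j
  by_cases h : j = i
  · subst h; simp
  · simp [h]

lemma IsCkb.exists_partialDeriv_bound {k : ℕ} {g : (Fin d → ℝ) → ℝ} (h : IsCkb k g)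
    (hk : 1 ≤ k) : ∃ K : ℝ, 0 ≤ K ∧ ∀ i y, |partialDeriv i g y| ≤ K := by
  obtain ⟨K, hK0, hK⟩ := h.exists_fderiv_bound hk
  refine ⟨K, hK0, fun i y => ?_⟩
  rw [← Real.norm_eq_abs]
  calc _ ≤ ‖fderiv ℝ g y‖ * ‖(Pi.single i 1 : Fin d → ℝ)‖ := ContinuousLinearMap.le_opNorm _ _
    _ ≤ K * 1 := mul_le_mul (hK y) (norm_single_one_le i) (norm_nonneg _) hK0
    _ = K := mul_one K

lemma IsCkb.exists_partialDeriv₂_bound {k : ℕ} {g : (Fin d → ℝ) → ℝ} (h : IsCkb k g)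
    (hk : 2 ≤ k) : ∃ K : ℝ, 0 ≤ K ∧ ∀ i j y, |partialDeriv i (partialDeriv j g) y| ≤ K := by
  obtain ⟨K, hK⟩ := h.2 2 hk
  have hK0 : 0 ≤ K := (norm_nonneg _).trans (hK 0)
  have h1 : ContDiff ℝ 1 (fderiv ℝ g) :=
    h.1.fderiv_right (m := 1) (by exact_mod_cast hk)
  have h2 : ∀ y, ‖fderiv ℝ (fderiv ℝ g) y‖ ≤ K := fun y => by
    have := hK y
    rwa [← norm_iteratedFDeriv_fderiv, norm_iteratedFDeriv_one] at this
  refine ⟨K, hK0, fun i j y => ?_⟩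
  have h3 : partialDeriv i (partialDeriv j g) y
      = fderiv ℝ (fderiv ℝ g) y (Pi.single i 1) (Pi.single j 1) := by
    have hd := ((h1.differentiable one_ne_zero) y).hasFDerivAt.clm_apply
      (hasFDerivAt_const (Pi.single j 1 : Fin d → ℝ) y)
    change fderiv ℝ (fun y => fderiv ℝ g y (Pi.single j 1)) y (Pi.single i 1) = _
    rw [hd.fderiv]
    simp
  rw [h3, ← Real.norm_eq_abs]
  calc _ ≤ ‖fderiv ℝ (fderiv ℝ g) y (Pi.single i 1)‖ * ‖(Pi.single j 1 : Fin d → ℝ)‖ :=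
        ContinuousLinearMap.le_opNorm _ _
    _ ≤ (‖fderiv ℝ (fderiv ℝ g) y‖ * ‖(Pi.single i 1 : Fin d → ℝ)‖)
        * ‖(Pi.single j 1 : Fin d → ℝ)‖ := by
          gcongr; exact ContinuousLinearMap.le_opNorm _ _
    _ ≤ (K * 1) * 1 := by
          gcongr
          · exact h2 y
          · exact norm_single_one_le i
          · exact norm_single_one_le j
    _ = K := by ring

end Ckb

lemma exists_common_bound {ι : Type*} [Fintype ι] {Q : ι → ℝ → Prop}
    (mono : ∀ i K K', K ≤ K' → Q i K → Q i K') (h : ∀ i, ∃ K, 0 ≤ K ∧ Q i K) :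
    ∃ K, 0 ≤ K ∧ ∀ i, Q i K := by
  choose K hK0 hK using h
  refine ⟨∑ i, K i, Finset.sum_nonneg fun i _ => hK0 i, fun i => mono i _ _ ?_ (hK i)⟩
  exact Finset.single_le_sum (f := K) (fun i _ => hK0 i) (Finset.mem_univ i)

/-! ### Consequences of ellipticity, and uniform constants for the coefficients. -/

namespace Model

variable {d m : ℕ} {S : Model d m} {a₁ a₂ lam₁ lam₂ : ℝ}

/-- Ellipticity is tested at x and compared with the largest coordinate: a₁|x i₀|² ≤ x·(a x) ≤ |x
i₀| ∑|(a x)_j|, and one factor cancels. Invertibility of a and the bounds for (t a)⁻¹ follow from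
this coordinatewise, without spectral theory. -/
lemma IsAdmissible.abs_apply_le (hS : S.IsAdmissible a₁ a₂ lam₁ lam₂) (y x : Fin d → ℝ)
    (i : Fin d) : |x i| ≤ (∑ j, |(S.a y *ᵥ x) j|) / a₁ := by
  set R := S.a y *ᵥ x with hR
  have ha := hS.a₁_pos
  have hsum : 0 ≤ ∑ j, |R j| := Finset.sum_nonneg fun j _ => abs_nonneg _
  obtain ⟨i₀, -, hi₀⟩ := Finset.exists_max_image Finset.univ (fun i => |x i|) ⟨i, Finset.mem_univ i⟩
  refine (hi₀ i (Finset.mem_univ i)).trans ?_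
  have h1 : a₁ * |x i₀| ^ 2 ≤ |x i₀| * ∑ j, |R j| := by
    calc a₁ * |x i₀| ^ 2 ≤ a₁ * ∑ i, x i ^ 2 := by
          gcongr
          rw [sq_abs]
          exact Finset.single_le_sum (f := fun i => x i ^ 2) (fun i _ => sq_nonneg _)
            (Finset.mem_univ i₀)
      _ ≤ x ⬝ᵥ R := hS.elliptic_lower y x
      _ ≤ ∑ j, |x j| * |R j| := by
          rw [dotProduct]
          exact Finset.sum_le_sum fun j _ => (le_abs_self _).trans (abs_mul _ _).le
      _ ≤ ∑ j, |x i₀| * |R j| := by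
          exact Finset.sum_le_sum fun j _ =>
            mul_le_mul_of_nonneg_right (hi₀ j (Finset.mem_univ j)) (abs_nonneg _)
      _ = _ := (Finset.mul_sum _ _ _).symm
  rw [le_div_iff₀ ha]
  rcases (abs_nonneg (x i₀)).eq_or_lt with h0 | h0
  · rw [← h0]; simpa using hsum
  · nlinarith

lemma IsAdmissible.isUnit_det (hS : S.IsAdmissible a₁ a₂ lam₁ lam₂) (y : Fin d → ℝ) :
    IsUnit (S.a y).det := by
  rw [isUnit_iff_ne_zero]
  intro h
  obtain ⟨v, hv, hv0⟩ := Matrix.exists_mulVec_eq_zero_iff.mpr h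
  apply hv
  funext i
  have := hS.abs_apply_le y v i
  rw [hv0] at this
  simpa using this

lemma IsAdmissible.abs_inv_mulVec_le (hS : S.IsAdmissible a₁ a₂ lam₁ lam₂) {t : ℝ} (ht : 0 < t)
    (y R : Fin d → ℝ) (i : Fin d) :
    |((t • S.a y)⁻¹ *ᵥ R) i| ≤ (∑ j, |R j|) / (a₁ * t) := by
  have hu := hS.isUnit_det y
  have hut : IsUnit (t • S.a y).det := by
    rw [Matrix.det_smul, isUnit_iff_ne_zero]
    exact mul_ne_zero (pow_ne_zero _ ht.ne') hu.ne_zero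
  have h := hS.abs_apply_le y ((t • S.a y)⁻¹ *ᵥ R) i
  have h2 : S.a y *ᵥ ((t • S.a y)⁻¹ *ᵥ R) = t⁻¹ • R := by
    have : (t • S.a y) *ᵥ ((t • S.a y)⁻¹ *ᵥ R) = R := by
      rw [Matrix.mulVec_mulVec, Matrix.mul_nonsing_inv _ hut, Matrix.one_mulVec]
    rw [Matrix.smul_mulVec] at this
    rw [← this, smul_smul, inv_mul_cancel₀ ht.ne', one_smul, this]
  rw [h2] at h
  refine h.trans (le_of_eq ?_)
  simp only [Pi.smul_apply, smul_eq_mul, abs_mul, ← Finset.mul_sum, abs_inv, abs_of_pos ht]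
  field_simp

lemma IsAdmissible.abs_inv_le (hS : S.IsAdmissible a₁ a₂ lam₁ lam₂) {t : ℝ} (ht : 0 < t)
    (y : Fin d → ℝ) (i j : Fin d) : |(t • S.a y)⁻¹ i j| ≤ 1 / (a₁ * t) := by
  have h := hS.abs_inv_mulVec_le ht y (Pi.single j 1) i
  have h2 : ∑ k, |(Pi.single j 1 : Fin d → ℝ) k| = 1 := by
    simp [Pi.single_apply, apply_ite abs]
  rw [h2] at h
  simpa using h

/-- The diagonal entries of a are the squared lengths of the rows of σ. -/
lemma IsAdmissible.abs_sigma_le (hS : S.IsAdmissible a₁ a₂ lam₁ lam₂) (y : Fin d → ℝ)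
    (i : Fin d) (k : Fin m) : |S.sigma y i k| ≤ √a₂ := by
  apply Real.le_sqrt_of_sq_le
  have h := hS.elliptic_upper y (Pi.single i 1)
  have h1 : (Pi.single i 1 : Fin d → ℝ) ⬝ᵥ (S.a y *ᵥ Pi.single i 1) = S.a y i i := by simp
  have h2 : ∑ k, (Pi.single i 1 : Fin d → ℝ) k ^ 2 = 1 := by
    simp [Pi.single_apply]
  rw [h1, h2, mul_one] at h
  refine le_trans ?_ h
  rw [sq_abs]
  simp only [Model.a, Matrix.mul_apply, Matrix.transpose_apply, ← sq]
  exact Finset.single_le_sum (f := fun k => S.sigma y i k ^ 2) (fun _ _ => sq_nonneg _)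
    (Finset.mem_univ k)

lemma IsAdmissible.abs_sigma_mulVec_le (hS : S.IsAdmissible a₁ a₂ lam₁ lam₂) (y : Fin d → ℝ)
    (w : Fin m → ℝ) (i : Fin d) : |(S.sigma y *ᵥ w) i| ≤ √a₂ * ∑ k, |w k| := by
  rw [Matrix.mulVec, dotProduct, Finset.mul_sum]
  refine (Finset.abs_sum_le_sum_abs _ _).trans (Finset.sum_le_sum fun k _ => ?_)
  rw [abs_mul]
  gcongr
  exact hS.abs_sigma_le y i k

/-- Uniform constants for the coefficients of an admissible model. -/
lemma IsAdmissible.exists_coefficient_bounds (hS : S.IsAdmissible a₁ a₂ lam₁ lam₂) :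
    ∃ K : ℝ, 0 ≤ K ∧ (∀ y, ‖S.mu y‖ ≤ K)
      ∧ (∀ i y₁ y₂, |S.mu y₂ i - S.mu y₁ i| ≤ K * ‖y₂ - y₁‖)
      ∧ (∀ i y, |partialDeriv i (fun y => S.mu y i) y| ≤ K)
      ∧ (∀ i j y₁ y₂, |S.a y₂ i j - S.a y₁ i j| ≤ K * ‖y₂ - y₁‖)
      ∧ (∀ i j k y, |partialDeriv k (fun y => S.a y i j) y| ≤ K)
      ∧ ∀ i j k l y, |partialDeriv k (partialDeriv l fun y => S.a y i j) y| ≤ K := by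
  obtain ⟨K1, h10, h1⟩ := hS.mu_reg.exists_bound
  obtain ⟨K2, h20, h2⟩ := hS.mu_reg.exists_lipschitz le_rfl
  obtain ⟨K3, h30, h3⟩ := hS.mu_reg.exists_fderiv_bound le_rfl
  obtain ⟨K4, h40, h4⟩ := exists_common_bound (ι := Fin d × Fin d)
    (Q := fun q K => ∀ y₁ y₂, |S.a y₂ q.1 q.2 - S.a y₁ q.1 q.2| ≤ K * ‖y₂ - y₁‖)
    (fun i K K' h hQ y₁ y₂ => (hQ y₁ y₂).trans (by gcongr))
    (fun q => (hS.a_reg q.1 q.2).exists_lipschitz (by norm_num))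
  obtain ⟨K5, h50, h5⟩ := exists_common_bound (ι := Fin d × Fin d)
    (Q := fun q K => ∀ k y, |partialDeriv k (fun y => S.a y q.1 q.2) y| ≤ K)
    (fun i K K' h hQ k y => (hQ k y).trans h)
    (fun q => (hS.a_reg q.1 q.2).exists_partialDeriv_bound (by norm_num))
  obtain ⟨K6, h60, h6⟩ := exists_common_bound (ι := Fin d × Fin d)
    (Q := fun q K => ∀ k l y, |partialDeriv k (partialDeriv l fun y => S.a y q.1 q.2) y| ≤ K)
    (fun i K K' h hQ k l y => (hQ k l y).trans h)
    (fun q => (hS.a_reg q.1 q.2).exists_partialDeriv₂_bound le_rfl)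
  refine ⟨K1 + K2 + K3 + K4 + K5 + K6, by positivity, fun y => (h1 y).trans (by linarith),
    fun i y₁ y₂ => ?_, fun i y => ?_, fun i j y₁ y₂ => (h4 (i, j) y₁ y₂).trans ?_,
    fun i j k y => (h5 (i, j) k y).trans (by linarith),
    fun i j k l y => (h6 (i, j) k l y).trans (by linarith)⟩
  · refine ((norm_le_pi_norm (S.mu y₂ - S.mu y₁) i).trans (h2 y₁ y₂)).trans ?_
    gcongr; linarith
  · have hd : HasFDerivAt (fun y => S.mu y i)
        ((ContinuousLinearMap.proj (R := ℝ) (φ := fun _ : Fin d => ℝ) i).comp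
          (fderiv ℝ S.mu y)) y :=
      (hasFDerivAt_pi'.mp ((hS.mu_reg.differentiable le_rfl) y).hasFDerivAt) i
    rw [partialDeriv, hd.fderiv]
    refine le_trans (norm_le_pi_norm (fderiv ℝ S.mu y (Pi.single i 1)) i) ?_
    refine (ContinuousLinearMap.le_opNorm _ _).trans ?_
    calc _ ≤ K3 * 1 := mul_le_mul (h3 y) (norm_single_one_le i) (norm_nonneg _) h30
      _ ≤ _ := by linarith
  · gcongr; linarith

end Model

/-! ### Bound for the parametrix weight along an Euler step -/

namespace Model

variable {d m : ℕ} {S : Model d m} {a₁ a₂ lam₁ lam₂ : ℝ}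

/-- The size `(∑ |w_k| + |wb|) / √t` of a Brownian increment over time `t`, after rescaling. -/
def scaledSize (t : ℝ) (w : Fin m → ℝ) (wb : ℝ) : ℝ := (∑ k, |w k| + |wb|) / √t

lemma scaledSize_nonneg (t : ℝ) (w : Fin m → ℝ) (wb : ℝ) : 0 ≤ scaledSize t w wb := by
  unfold scaledSize; positivity

lemma abs_add_three_le (a b c e : ℝ) : |a + b + c + e| ≤ |a| + |b| + |c| + |e| :=
  (abs_add_le _ _).trans (by linarith [abs_add_le (a + b) c, abs_add_le a b])

/-- The decisive term is the difference of `a`, of size √t P with P = 1 + N, times the second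
Hermite polynomial, of size P²/t. This explains the third power; the other terms are no more
singular and of lower degree in P. -/
lemma IsAdmissible.exists_abs_theta_le (hS : S.IsAdmissible a₁ a₂ lam₁ lam₂) {T : ℝ} (hT : 0 < T) :
    ∃ C : ℝ, 0 < C ∧ ∀ t, 0 < t → t ≤ T → ∀ (z : (Fin d → ℝ) × ℝ) (w : Fin m → ℝ) (wb : ℝ),
      |S.theta t z (S.eulerStep z t w wb)| ≤ C * ((1 + scaledSize t w wb) ^ 3 / √t) := by
  obtain ⟨K, hK0, hmu, hmul, hmud, hal, had, hadd⟩ := hS.exists_coefficient_bounds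
  have ha₁ := hS.a₁_pos
  have ha₂ : 0 < a₂ := ha₁.trans_le hS.a₁_le_a₂
  have hsA := hS.sigmaA_pos
  have hlam₂ : 0 < lam₂ := hS.lam₁_pos.trans_le ((hS.lam_lower 0).trans (hS.lam_upper 0))
  set r0 := √T with hr0
  have hr0p : 0 < r0 := Real.sqrt_pos.mpr hT
  -- With r = √t, the displacement is at most B r P and (t a)⁻¹ applied to the noise at most H P /
  -- r. V and U are the resulting multiples of P³ / r for the second and first order parts; a spare
  -- factor √t is bounded by √T.
  set B : ℝ := r0 * K + √a₂ with hB
  set H : ℝ := d * √a₂ / a₁ with hH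
  have hB0 : 0 ≤ B := by positivity
  have hH0 : 0 ≤ H := by positivity
  set V : ℝ := K * r0 + K * H + K * H + K * B * (H ^ 2 + 1 / a₁) with hV
  set U : ℝ := K * r0 + K * B * H * r0 with hU
  have hV0 : 0 ≤ V := by positivity
  have hU0 : 0 ≤ U := by positivity
  refine ⟨1 / 2 * (d * (d * V)) + d * U + lam₂ / S.sigmaA, by positivity, fun t ht htT z w wb => ?_⟩
  set P : ℝ := 1 + scaledSize t w wb with hP
  set r : ℝ := √t with hr
  have hrp : 0 < r := Real.sqrt_pos.mpr ht
  have hrr : t = r ^ 2 := (Real.sq_sqrt ht.le).symm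
  have hrr0 : r ≤ r0 := Real.sqrt_le_sqrt htT
  have hP1 : 1 ≤ P := by have := scaledSize_nonneg t w wb; linarith
  have hP0 : 0 < P := by linarith
  have hN : ∑ k, |w k| + |wb| ≤ r * P := by
    have : ∑ k, |w k| + |wb| = r * scaledSize t w wb := by
      rw [scaledSize, ← hr]; field_simp
    rw [this]
    exact mul_le_mul_of_nonneg_left (by linarith) hrp.le
  have hw : ∑ k, |w k| ≤ r * P := by linarith [abs_nonneg wb]
  have hwb : |wb| ≤ r * P := by
    linarith [Finset.sum_nonneg (s := Finset.univ) fun k _ => abs_nonneg (w k)]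
  have hP3 : P ^ 2 ≤ P ^ 3 := pow_le_pow_right₀ hP1 (by norm_num)
  have hP3' : P ≤ P ^ 3 := by simpa using pow_le_pow_right₀ hP1 (show 1 ≤ 3 by norm_num)
  have hP3'' : 1 ≤ P ^ 3 := one_le_pow₀ hP1
  set z₂ := S.eulerStep z t w wb with hz₂
  have hR : z₂.1 - z.1 - t • S.mu z.1 = S.sigma z.1 *ᵥ w := by
    simp only [hz₂, eulerStep]; abel
  have hσ : ∀ i, |(S.sigma z.1 *ᵥ w) i| ≤ √a₂ * (r * P) := fun i =>
    (hS.abs_sigma_mulVec_le z.1 w i).trans (by gcongr)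
  have hΔ : ‖z₂.1 - z.1‖ ≤ B * (r * P) := by
    have : z₂.1 - z.1 = t • S.mu z.1 + S.sigma z.1 *ᵥ w := by rw [← hR]; abel
    rw [this]
    refine (norm_add_le _ _).trans ?_
    have e1 : ‖t • S.mu z.1‖ ≤ r0 * K * (r * P) := by
      rw [norm_smul, Real.norm_of_nonneg ht.le, hrr]
      calc r ^ 2 * ‖S.mu z.1‖ ≤ (r0 * r) * K := by
            rw [sq]; gcongr; exact hmu _
        _ ≤ (r0 * r) * K * P := le_mul_of_one_le_right (by positivity) hP1
        _ = _ := by ring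
    have e2 : ‖S.sigma z.1 *ᵥ w‖ ≤ √a₂ * (r * P) :=
      (pi_norm_le_iff_of_nonneg (by positivity)).mpr hσ
    rw [hB]; linarith
  have hRs : ∑ j, |(S.sigma z.1 *ᵥ w) j| ≤ d * (√a₂ * (r * P)) := by
    refine (Finset.sum_le_sum fun j _ => hσ j).trans ?_
    simp
  have hinv : ∀ i, |((t • S.a z.1)⁻¹ *ᵥ (S.sigma z.1 *ᵥ w)) i| ≤ H * P / r := fun i => by
    refine (hS.abs_inv_mulVec_le ht _ _ i).trans ?_
    calc _ ≤ d * (√a₂ * (r * P)) / (a₁ * t) := by gcongr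
      _ = _ := by rw [hH, hrr]; field_simp
  have hh1 : ∀ i, |S.h1 t z.1 z₂.1 i| ≤ H * P / r := fun i => by
    rw [h1, hermite1, hR, abs_neg]; exact hinv i
  have hh2 : ∀ i j, |S.h2 t z.1 z₂.1 i j| ≤ (H ^ 2 + 1 / a₁) * P ^ 2 / r ^ 2 := fun i j => by
    rw [h2, hermite2, hR]
    refine (abs_sub _ _).trans ?_
    rw [abs_mul]
    have e1 := mul_le_mul (hinv i) (hinv j) (abs_nonneg _) (by positivity)
    have e2 : |(t • S.a z.1)⁻¹ i j| ≤ 1 / a₁ * P ^ 2 / r ^ 2 := by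
      refine (hS.abs_inv_le ht _ i j).trans ?_
      rw [hrr, div_mul_eq_mul_div, one_mul, div_div]
      gcongr
      exact one_le_pow₀ hP1
    calc _ ≤ H * P / r * (H * P / r) + 1 / a₁ * P ^ 2 / r ^ 2 := add_le_add e1 e2
      _ = _ := by ring
  -- Bounded terms fit the required form because √t ≤ √T and P ≥ 1.
  have hconst : ∀ c, 0 ≤ c → c ≤ c * r0 * (P ^ 3 / r) := fun c hc => by
    have : 1 ≤ r0 * (P ^ 3 / r) := by
      rw [← mul_div_assoc, le_div_iff₀ hrp, one_mul]
      nlinarith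
    calc c = c * 1 := (mul_one c).symm
      _ ≤ c * (r0 * (P ^ 3 / r)) := by gcongr
      _ = _ := by ring
  have hIJ : ∀ i j, |S.varthetaIJ t z.1 z₂.1 i j| ≤ V * (P ^ 3 / r) := fun i j => by
    rw [varthetaIJ]
    refine (abs_add_three_le _ _ _ _).trans ?_
    rw [abs_mul, abs_mul, abs_mul]
    have e1 : |partialDeriv i (partialDeriv j fun y => S.a y i j) z₂.1| ≤ K * r0 * (P ^ 3 / r) :=
      (hadd i j i j _).trans (hconst K hK0)
    have e0 : H * P / r ≤ H * (P ^ 3 / r) := by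
      rw [mul_div_assoc]; gcongr
    have e2 : |partialDeriv j (fun y => S.a y i j) z₂.1| * |S.h1 t z.1 z₂.1 i|
        ≤ K * (H * (P ^ 3 / r)) :=
      mul_le_mul (had i j j _) ((hh1 i).trans e0) (abs_nonneg _) hK0
    have e3 : |partialDeriv i (fun y => S.a y i j) z₂.1| * |S.h1 t z.1 z₂.1 j|
        ≤ K * (H * (P ^ 3 / r)) :=
      mul_le_mul (had i j i _) ((hh1 j).trans e0) (abs_nonneg _) hK0
    have e4 : |S.a z₂.1 i j - S.a z.1 i j| * |S.h2 t z.1 z₂.1 i j|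
        ≤ K * (B * (r * P)) * ((H ^ 2 + 1 / a₁) * P ^ 2 / r ^ 2) :=
      mul_le_mul ((hal i j _ _).trans (by gcongr)) (hh2 i j) (abs_nonneg _) (by positivity)
    have e5 : K * (B * (r * P)) * ((H ^ 2 + 1 / a₁) * P ^ 2 / r ^ 2)
        = K * B * (H ^ 2 + 1 / a₁) * (P ^ 3 / r) := by field_simp
    rw [hV]; linarith
  have hrho : ∀ i, |S.rhoI t z.1 z₂.1 i| ≤ U * (P ^ 3 / r) := fun i => by
    rw [rhoI]
    refine (abs_add_le _ _).trans ?_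
    rw [abs_mul]
    have e1 := (hmud i z₂.1).trans (hconst K hK0)
    have e2 : |S.mu z₂.1 i - S.mu z.1 i| * |S.h1 t z.1 z₂.1 i|
        ≤ K * (B * (r * P)) * (H * P / r) :=
      mul_le_mul ((hmul i _ _).trans (by gcongr)) (hh1 i) (abs_nonneg _) (by positivity)
    have e3 : K * (B * (r * P)) * (H * P / r) ≤ K * B * H * r0 * (P ^ 3 / r) := by
      have e4 : K * (B * (r * P)) * (H * P / r) = K * B * H * (P ^ 2 * r / r) := by ring
      have e5 : K * B * H * r0 * (P ^ 3 / r) = K * B * H * (P ^ 3 * r0 / r) := by ring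
      rw [e4, e5]
      exact mul_le_mul_of_nonneg_left (div_le_div_of_nonneg_right
        (mul_le_mul hP3 hrr0 hrp.le (by positivity)) hrp.le) (by positivity)
    rw [hU]; linarith
  have hlam : |(S.lam z₂.1 - S.lam z.1) * ((z₂.2 - z.2 - S.lam z.1 * t) / (t * S.sigmaA ^ 2))|
      ≤ lam₂ / S.sigmaA * (P ^ 3 / r) := by
    have e1 : z₂.2 - z.2 - S.lam z.1 * t = S.sigmaA * wb := by
      simp only [hz₂, eulerStep]; ring
    -- λ need not be Lipschitz: both values lie in (0, lam₂], and the remaining quotient is already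
    -- of order 1/√t.
    have e2 : |S.lam z₂.1 - S.lam z.1| ≤ lam₂ := by
      rw [abs_le]
      constructor <;> linarith [hS.lam_lower z₂.1, hS.lam_upper z₂.1, hS.lam_lower z.1,
        hS.lam_upper z.1, hS.lam₁_pos]
    rw [e1, abs_mul, abs_div, abs_mul, abs_of_pos hsA,
      abs_of_pos (by positivity : 0 < t * S.sigmaA ^ 2)]
    calc _ ≤ lam₂ * (S.sigmaA * (r * P ^ 3) / (t * S.sigmaA ^ 2)) := by
          gcongr
          exact hwb.trans (by gcongr)
      _ = _ := by rw [hrr]; field_simp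
  have hQ : 0 ≤ P ^ 3 / r := by positivity
  have hv : |S.vartheta t z.1 z₂.1| ≤ (1 / 2 * (d * (d * V)) + d * U) * (P ^ 3 / r) := by
    rw [vartheta]
    refine (abs_sub _ _).trans ?_
    rw [abs_mul, abs_of_pos (by norm_num : (0 : ℝ) < 1 / 2)]
    have e1 : |∑ i, ∑ j, S.varthetaIJ t z.1 z₂.1 i j| ≤ d * (d * (V * (P ^ 3 / r))) := by
      refine (Finset.abs_sum_le_sum_abs _ _).trans ?_
      refine (Finset.sum_le_sum fun i _ => (Finset.abs_sum_le_sum_abs _ _).trans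
        (Finset.sum_le_sum fun j _ => hIJ i j)).trans ?_
      simp
    have e2 : |∑ i, S.rhoI t z.1 z₂.1 i| ≤ d * (U * (P ^ 3 / r)) := by
      refine (Finset.abs_sum_le_sum_abs _ _).trans ?_
      refine (Finset.sum_le_sum fun i _ => hrho i).trans ?_
      simp
    linarith
  rw [theta]
  refine (abs_add_le _ _).trans ?_
  linarith

/-- Unlike a power of 1 + N, an exponential of N factors over the components of the increment and
over the steps. -/
lemma exists_one_add_rpow_le_exp (q : ℝ) :
    ∃ C : ℝ, 0 < C ∧ ∀ u : ℝ, 0 ≤ u → (1 + u) ^ q ≤ C * Real.exp u := by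
  obtain ⟨n, hn⟩ := exists_nat_ge q
  refine ⟨n.factorial * Real.exp 1, by positivity, fun u hu => ?_⟩
  calc (1 + u) ^ q ≤ (1 + u) ^ (n : ℝ) := Real.rpow_le_rpow_of_exponent_le (by linarith) hn
    _ = (1 + u) ^ n := Real.rpow_natCast _ _
    _ ≤ n.factorial * Real.exp (1 + u) := by
        have := Real.pow_div_factorial_le_exp (1 + u) (by linarith) n
        rwa [div_le_iff₀ (by positivity), mul_comm] at this
    _ = _ := by rw [Real.exp_add]; ring

lemma IsAdmissible.exists_abs_theta_rpow_le (hS : S.IsAdmissible a₁ a₂ lam₁ lam₂) {T p : ℝ}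
    (hT : 0 < T) (hp : 0 < p) :
    ∃ C : ℝ, 0 < C ∧ ∀ t, 0 < t → t ≤ T → ∀ (z : (Fin d → ℝ) × ℝ) (w : Fin m → ℝ) (wb : ℝ),
      |S.theta t z (S.eulerStep z t w wb)| ^ p
        ≤ C * t ^ (-p / 2) * Real.exp (scaledSize t w wb) := by
  obtain ⟨C, hC, h⟩ := hS.exists_abs_theta_le hT
  obtain ⟨C', hC', h'⟩ := exists_one_add_rpow_le_exp (3 * p)
  refine ⟨C ^ p * C', by positivity, fun t ht htT z w wb => ?_⟩
  have hN := scaledSize_nonneg t w wb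
  calc |S.theta t z (S.eulerStep z t w wb)| ^ p
      ≤ (C * ((1 + scaledSize t w wb) ^ 3 / √t)) ^ p :=
        Real.rpow_le_rpow (abs_nonneg _) (h t ht htT z w wb) hp.le
    _ = C ^ p * (1 + scaledSize t w wb) ^ (3 * p) * t ^ (-p / 2) := by
        rw [Real.mul_rpow hC.le (by positivity), Real.div_rpow (by positivity) (by positivity),
          ← Real.rpow_natCast (1 + scaledSize t w wb) 3, ← Real.rpow_mul (by positivity),
          Real.sqrt_eq_rpow, ← Real.rpow_mul ht.le, div_eq_mul_inv, ← Real.rpow_neg ht.le]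
        norm_num
        rw [show -(1 / 2 * p) = -p / 2 by ring]
        ring
    _ ≤ C ^ p * (C' * Real.exp (scaledSize t w wb)) * t ^ (-p / 2) := by
        gcongr
        exact h' _ hN
    _ = _ := by ring

end Model

/-! ### The Euler chain on a deterministic grid -/

section Independence

variable {Ω α β : Type*} [MeasurableSpace Ω] [MeasurableSpace α] [MeasurableSpace β]
  {P : Measure Ω}

/-- Fubini for the product law. The second variable is integrated with the first one frozen, which
replaces conditional expectations throughout. -/
lemma lintegral_comp_prodMk_of_indepFun [IsProbabilityMeasure P] {X : Ω → α} {Y : Ω → β}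
    (hX : Measurable X)
    (hY : Measurable Y) (h : IndepFun X Y P) {g : α → β → ℝ≥0∞}
    (hg : Measurable (Function.uncurry g)) :
    ∫⁻ ω, g (X ω) (Y ω) ∂P = ∫⁻ ω, ∫⁻ ω', g (X ω) (Y ω') ∂P ∂P := by
  have : IsProbabilityMeasure (P.map X) := Measure.isProbabilityMeasure_map hX.aemeasurable
  have : IsProbabilityMeasure (P.map Y) := Measure.isProbabilityMeasure_map hY.aemeasurable
  have h1 := (indepFun_iff_map_prod_eq_prod_map_map hX.aemeasurable hY.aemeasurable).mp h
  calc ∫⁻ ω, g (X ω) (Y ω) ∂P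
      = ∫⁻ q, Function.uncurry g q ∂(P.map fun ω => (X ω, Y ω)) := by
        rw [lintegral_map hg (hX.prodMk hY)]; rfl
    _ = ∫⁻ a, ∫⁻ b, g a b ∂(P.map Y) ∂(P.map X) := by
        rw [h1, lintegral_prod _ hg.aemeasurable]; rfl
    _ = ∫⁻ a, ∫⁻ ω', g a (Y ω') ∂P ∂(P.map X) := by
        congr with a
        rw [lintegral_map (hg.of_uncurry_left) hY]
    _ = _ := by
        rw [lintegral_map _ hX]
        have := (hg.comp (measurable_fst.prodMk (hY.comp measurable_snd))).lintegral_prod_right'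
          (ν := P)
        exact this

lemma lintegral_mul_le_of_indepFun [IsProbabilityMeasure P] {X : Ω → α} {Y : Ω → β}
    (hX : Measurable X)
    (hY : Measurable Y) (h : IndepFun X Y P) {F : α → ℝ≥0∞} (hF : Measurable F)
    {g : α → β → ℝ≥0∞} (hg : Measurable (Function.uncurry g)) {c : ℝ≥0∞}
    (hc : ∀ a, ∫⁻ ω, g a (Y ω) ∂P ≤ c) :
    ∫⁻ ω, F (X ω) * g (X ω) (Y ω) ∂P ≤ c * ∫⁻ ω, F (X ω) ∂P := by
  rw [lintegral_comp_prodMk_of_indepFun (g := fun a b => F a * g a b) hX hY h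
    ((hF.comp measurable_fst).mul hg), mul_comm,
    ← lintegral_mul_const (f := fun ω => F (X ω)) _ (hF.comp hX)]
  refine lintegral_mono fun ω => ?_
  have hgY : Measurable fun ω' => g (X ω) (Y ω') := hg.of_uncurry_left.comp hY
  rw [lintegral_const_mul _ hgY]
  gcongr
  exact hc _

/-- For independent variables `D j i`, an estimate of the `k`-th step that is uniform in the
past can be integrated over the past. -/
lemma lintegral_mul_le_of_iIndepFun [IsProbabilityMeasure P] {ι : Type*} [Fintype ι]
    {D : ℕ → ι → Ω → ℝ} (hD : ∀ k i, Measurable (D k i))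
    (hind : iIndepFun (fun (q : ι × ℕ) => D q.2 q.1) P) (k : ℕ)
    {F : (ℕ → ι → ℝ) → ℝ≥0∞} {g : (ℕ → ι → ℝ) → (ι → ℝ) → ℝ≥0∞} (hF : Measurable F)
    (hg : Measurable (Function.uncurry g)) (hF_congr : ∀ a b, (∀ j < k, a j = b j) → F a = F b)
    (hg_congr : ∀ a b, (∀ j < k, a j = b j) → g a = g b) {c : ℝ≥0∞}
    (hc : ∀ a, ∫⁻ ω, g a (fun i => D k i ω) ∂P ≤ c) :
    ∫⁻ ω, F (fun j i => D j i ω) * g (fun j i => D j i ω) (fun i => D k i ω) ∂P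
      ≤ c * ∫⁻ ω, F (fun j i => D j i ω) ∂P := by
  let past : Finset (ι × ℕ) := Finset.univ ×ˢ Finset.range k
  let now : Finset (ι × ℕ) := Finset.univ ×ˢ {k}
  have hdisj : Disjoint past now := by
    rw [Finset.disjoint_left]
    rintro ⟨o, j⟩ h1 h2
    simp only [past, now, Finset.mem_product, Finset.mem_univ, Finset.mem_range, true_and,
      Finset.mem_singleton] at h1 h2
    omega
  have hmem : ∀ o j, j < k → (o, j) ∈ past := fun o j h => by simp [past, h]
  have hmem' : ∀ o, (o, k) ∈ now := fun o => by simp [now]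
  -- The past is extended by 0 to a full sequence; the congruence hypotheses say that F and g do not
  -- see the extension.
  let φ : (past → ℝ) → ℕ → ι → ℝ := fun X j o =>
    if h : j < k then X ⟨(o, j), hmem o j h⟩ else 0
  have hφ : Measurable φ := by
    refine measurable_pi_lambda _ fun j => measurable_pi_lambda _ fun o => ?_
    by_cases h : j < k
    · simp only [φ, h, dif_pos]; exact measurable_pi_apply _
    · simp only [φ, h, dif_neg, not_false_eq_true]; exact measurable_const
  let ψ : (now → ℝ) → ι → ℝ := fun Y o => Y ⟨(o, k), hmem' o⟩
  have hψ : Measurable ψ := measurable_pi_lambda _ fun o => measurable_pi_apply _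
  have hXY := (hind.indepFun_finset past now hdisj (fun q => hD q.2 q.1)).comp hφ hψ
  set X : Ω → ℕ → ι → ℝ := φ ∘ fun ω (i : past) => D i.1.2 i.1.1 ω with hX
  have hXm : Measurable X := hφ.comp (measurable_pi_lambda _ fun i => hD _ _)
  have hYm : Measurable fun ω i => D k i ω := measurable_pi_lambda _ fun i => hD _ _
  have hXD : ∀ ω, ∀ j < k, (fun o => D j o ω) = X ω j := fun ω j hj => by
    funext o; simp [hX, φ, hj]
  have h1 : ∀ ω, F (fun j i => D j i ω) = F (X ω) := fun ω => hF_congr _ _ (hXD ω)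
  have h2 : ∀ ω, g (fun j i => D j i ω) = g (X ω) := fun ω => hg_congr _ _ (hXD ω)
  simp only [h1, h2]
  exact lintegral_mul_le_of_indepFun hXm hYm hXY hF hg hc

end Independence

/-! ### Exponential moments of Gaussian variables. -/

section Gaussian

lemma lintegral_exp_mul_gaussianReal (a : ℝ) (v : ℝ≥0) :
    ∫⁻ x, ENNReal.ofReal (Real.exp (a * x)) ∂(gaussianReal 0 v)
      = ENNReal.ofReal (Real.exp (v * a ^ 2 / 2)) := by
  rw [← ofReal_integral_eq_lintegral_ofReal (integrable_exp_mul_gaussianReal a)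
    (Filter.Eventually.of_forall fun _ => (Real.exp_pos _).le)]
  have := congrFun (mgf_id_gaussianReal (μ := 0) (v := v)) a
  rw [mgf] at this
  simp only [id] at this
  rw [this]; simp

/-- The integrand is at most the sum of e^((b ± c)x) with c = 1/√v, and v(b ± c)²/2 ≤ b²v + c²v ≤
b²v + 1. Hence the rescaled absolute value costs a factor that does not depend on v. -/
lemma lintegral_exp_mul_add_abs_gaussianReal_le (b : ℝ) (v : ℝ≥0) :
    ∫⁻ x, ENNReal.ofReal (Real.exp (b * x + |x| / √v)) ∂(gaussianReal 0 v)
      ≤ ENNReal.ofReal (2 * Real.exp 1 * Real.exp (b ^ 2 * v)) := by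
  set c : ℝ := 1 / √v with hc
  -- For v = 0 division by zero gives c = 0, so only an inequality holds. Steps of length zero do
  -- occur in the grids below.
  have hcv : c ^ 2 * v ≤ 1 := by
    rw [hc, div_pow, one_pow, Real.sq_sqrt v.coe_nonneg, one_div]
    exact inv_mul_le_one
  have key : ∀ a : ℝ, a ^ 2 ≤ 2 * (b ^ 2 + c ^ 2) →
      Real.exp (v * a ^ 2 / 2) ≤ Real.exp 1 * Real.exp (b ^ 2 * v) := fun a ha => by
    rw [← Real.exp_add]
    apply Real.exp_le_exp.mpr
    have := mul_le_mul_of_nonneg_left ha v.2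
    nlinarith
  calc _ ≤ ∫⁻ x, (ENNReal.ofReal (Real.exp ((b + c) * x))
        + ENNReal.ofReal (Real.exp ((b - c) * x))) ∂(gaussianReal 0 v) := by
        refine lintegral_mono fun x => ?_
        rw [← ENNReal.ofReal_add (Real.exp_pos _).le (Real.exp_pos _).le]
        apply ENNReal.ofReal_le_ofReal
        rcases abs_choice x with h | h
        · have : b * x + |x| / √v = (b + c) * x := by rw [h, hc]; ring
          rw [this]; linarith [Real.exp_pos ((b - c) * x)]
        · have : b * x + |x| / √v = (b - c) * x := by rw [h, hc]; ring
          rw [this]; linarith [Real.exp_pos ((b + c) * x)]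
    _ = ENNReal.ofReal (Real.exp (v * (b + c) ^ 2 / 2))
        + ENNReal.ofReal (Real.exp (v * (b - c) ^ 2 / 2)) := by
        rw [lintegral_add_left (by fun_prop), lintegral_exp_mul_gaussianReal,
          lintegral_exp_mul_gaussianReal]
    _ ≤ _ := by
        rw [← ENNReal.ofReal_add (Real.exp_pos _).le (Real.exp_pos _).le]
        apply ENNReal.ofReal_le_ofReal
        have h1 := key (b + c) (by nlinarith [sq_nonneg (b - c)])
        have h2 := key (b - c) (by nlinarith [sq_nonneg (b + c)])
        linarith

end Gaussian

/-! ### Exponential weights along the Euler chain. -/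

namespace Model

variable {d m : ℕ} {S : Model d m} {a₁ a₂ lam₁ lam₂ : ℝ}

/-- The exponential weight gained in one Euler step of length `t` from `z`, with Brownian increments
`D none` of `Wbar` and `D (some i)` of the components of `W`. -/
def stepWeight (S : Model d m) (η : Fin d → ℝ) (p : ℝ) (z : (Fin d → ℝ) × ℝ) (t : ℝ)
    (D : Option (Fin m) → ℝ) : ℝ :=
  Real.exp (η ⬝ᵥ (t • S.mu z.1 + S.sigma z.1 *ᵥ fun i => D (some i))
    - p * (S.lam z.1 * t + S.sigmaA * D none) + scaledSize t (fun i => D (some i)) (D none))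

/-- The coefficients of the Brownian increments in the logarithm of `stepWeight`. -/
def stepCoeff (S : Model d m) (η : Fin d → ℝ) (p : ℝ) (y : Fin d → ℝ) : Option (Fin m) → ℝ
  | none => -(p * S.sigmaA)
  | some k => ∑ i, η i * S.sigma y i k

/-- The exponent is linear in the increments up to the terms |D o|/√t, so it separates into
one-dimensional factors, which are independent. -/
lemma stepWeight_eq (η : Fin d → ℝ) (p : ℝ) (z : (Fin d → ℝ) × ℝ) (t : ℝ)
    (D : Option (Fin m) → ℝ) :
    S.stepWeight η p z t D = Real.exp (t * (η ⬝ᵥ S.mu z.1) - p * (S.lam z.1 * t))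
      * ∏ o, Real.exp (S.stepCoeff η p z.1 o * D o + |D o| / √t) := by
  rw [← Real.exp_sum, ← Real.exp_add, stepWeight]
  congr 1
  have h1 : η ⬝ᵥ (S.sigma z.1 *ᵥ fun i => D (some i))
      = ∑ k, (∑ i, η i * S.sigma z.1 i k) * D (some k) := by
    rw [Matrix.dotProduct_mulVec]; rfl
  rw [dotProduct_add, dotProduct_smul, h1, Fintype.sum_option, Finset.sum_add_distrib, scaledSize]
  simp only [stepCoeff, smul_eq_mul, add_div, Finset.sum_div]
  ring

/-- The coefficients along W form σᵀη, whose squared length is η·(aη). This is how a₂ enters the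
growth rate. -/
lemma IsAdmissible.sum_stepCoeff_sq_le (hS : S.IsAdmissible a₁ a₂ lam₁ lam₂) (η : Fin d → ℝ)
    (p : ℝ) (y : Fin d → ℝ) :
    ∑ o, S.stepCoeff η p y o ^ 2 ≤ p ^ 2 * S.sigmaA ^ 2 + a₂ * ∑ i, η i ^ 2 := by
  rw [Fintype.sum_option]
  simp only [stepCoeff]
  have h : ∑ k, (∑ i, η i * S.sigma y i k) ^ 2 = η ⬝ᵥ (S.a y *ᵥ η) := by
    have : S.a y *ᵥ η = S.sigma y *ᵥ (η ᵥ* S.sigma y) := by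
      rw [Model.a, ← Matrix.mulVec_mulVec, Matrix.mulVec_transpose]
    rw [this, Matrix.dotProduct_mulVec]
    simp [dotProduct, Matrix.vecMul, sq]
  rw [h]
  have := hS.elliptic_upper y η
  nlinarith

/-- The exponential growth rate of the expectation of `stepWeight`. -/
def stepRate (S : Model d m) (a₂ K : ℝ) (η : Fin d → ℝ) (p : ℝ) : ℝ :=
  K * ∑ i, |η i| + p ^ 2 * S.sigmaA ^ 2 + a₂ * ∑ i, η i ^ 2

lemma IsAdmissible.lintegral_stepWeight_le (hS : S.IsAdmissible a₁ a₂ lam₁ lam₂) {Kmu : ℝ}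
    (hmu : ∀ y, ‖S.mu y‖ ≤ Kmu) (η : Fin d → ℝ) {p : ℝ} (hp : 0 ≤ p)
    {Ω : Type*} [MeasurableSpace Ω] {P : Measure Ω} {D : Option (Fin m) → Ω → ℝ} {t : ℝ≥0}
    (hD : ∀ o, Measurable (D o)) (hlaw : ∀ o, P.map (D o) = gaussianReal 0 t)
    (hind : iIndepFun D P) (z : (Fin d → ℝ) × ℝ) :
    ∫⁻ ω, ENNReal.ofReal (S.stepWeight η p z t fun o => D o ω) ∂P
      ≤ ENNReal.ofReal ((2 * Real.exp 1) ^ (m + 1) * Real.exp (S.stepRate a₂ Kmu η p * t)) := by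
  have hmeas : ∀ o, Measurable fun x : ℝ =>
      ENNReal.ofReal (Real.exp (S.stepCoeff η p z.1 o * x + |x| / √t)) := fun o => by
    have : Measurable fun x : ℝ => |x| := measurable_id.abs
    fun_prop
  -- The λ term has a favourable sign, since p ≥ 0 and λ > 0, and is dropped.
  have hdrift : t * (η ⬝ᵥ S.mu z.1) - p * (S.lam z.1 * t) ≤ Kmu * (∑ i, |η i|) * t := by
    have h1 : η ⬝ᵥ S.mu z.1 ≤ Kmu * ∑ i, |η i| := by
      rw [dotProduct, Finset.mul_sum]
      refine Finset.sum_le_sum fun i _ => (le_abs_self _).trans ?_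
      rw [abs_mul, mul_comm]
      exact mul_le_mul_of_nonneg_right ((norm_le_pi_norm (S.mu z.1) i).trans (hmu _)) (abs_nonneg _)
    have h2 : 0 ≤ p * (S.lam z.1 * t) :=
      mul_nonneg hp (mul_nonneg (hS.lam₁_pos.le.trans (hS.lam_lower _)) t.2)
    nlinarith [mul_le_mul_of_nonneg_left h1 t.2]
  simp only [stepWeight_eq]
  calc _ = ∫⁻ ω, ENNReal.ofReal (Real.exp (t * (η ⬝ᵥ S.mu z.1) - p * (S.lam z.1 * t)))
        * ∏ o, ENNReal.ofReal (Real.exp (S.stepCoeff η p z.1 o * D o ω + |D o ω| / √t)) ∂P := by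
        congr with ω
        rw [ENNReal.ofReal_mul (Real.exp_pos _).le,
          ENNReal.ofReal_prod_of_nonneg fun _ _ => (Real.exp_pos _).le]
    _ = ENNReal.ofReal (Real.exp (t * (η ⬝ᵥ S.mu z.1) - p * (S.lam z.1 * t)))
        * ∏ o, ∫⁻ x, ENNReal.ofReal (Real.exp (S.stepCoeff η p z.1 o * x + |x| / √t))
          ∂(gaussianReal 0 t) := by
        have hm : ∀ o, Measurable fun ω =>
            ENNReal.ofReal (Real.exp (S.stepCoeff η p z.1 o * D o ω + |D o ω| / √t)) :=
          fun o => (hmeas o).comp (hD o)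
        rw [lintegral_const_mul _ (Finset.measurable_prod _ fun o _ => hm o)]
        rw [lintegral_prod_eq_prod_lintegral_of_indepFun Finset.univ
          (fun o ω => ENNReal.ofReal (Real.exp (S.stepCoeff η p z.1 o * D o ω + |D o ω| / √t)))
          (hind.comp _ hmeas) hm]
        congr 1
        refine Finset.prod_congr rfl fun o _ => ?_
        rw [← hlaw o, lintegral_map (hmeas o) (hD o)]
    _ ≤ ENNReal.ofReal (Real.exp (Kmu * (∑ i, |η i|) * t))
        * ∏ o, ENNReal.ofReal (2 * Real.exp 1 * Real.exp (S.stepCoeff η p z.1 o ^ 2 * t)) := by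
        gcongr with o
        exact lintegral_exp_mul_add_abs_gaussianReal_le _ _
    _ ≤ _ := by
        rw [← ENNReal.ofReal_prod_of_nonneg fun _ _ => by positivity,
          ← ENNReal.ofReal_mul (Real.exp_pos _).le, Finset.prod_mul_distrib, ← Real.exp_sum,
          Finset.prod_const, Finset.card_univ, Fintype.card_option, Fintype.card_fin,
          mul_left_comm, ← Real.exp_add, ← Finset.sum_mul]
        apply ENNReal.ofReal_le_ofReal
        gcongr
        have := mul_le_mul_of_nonneg_right (hS.sum_stepCoeff_sq_le η p z.1) t.coe_nonneg
        rw [stepRate]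
        linarith

/-- The Euler chain along the times `s`, with Brownian increments `D`, started at `(x, 0)`. -/
def chain (S : Model d m) (x : Fin d → ℝ) (s : ℕ → ℝ) (D : ℕ → Option (Fin m) → ℝ) :
    ℕ → (Fin d → ℝ) × ℝ
  | 0 => (x, 0)
  | k + 1 => S.eulerStep (chain S x s D k) (s (k + 1) - s k) (fun i => D k (some i)) (D k none)

/-- The exponential weight of the Euler chain after `k` steps. -/
def chainWeight (S : Model d m) (η : Fin d → ℝ) (p : ℝ) (x : Fin d → ℝ) (s : ℕ → ℝ)
    (D : ℕ → Option (Fin m) → ℝ) (k : ℕ) : ℝ :=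
  Real.exp (η ⬝ᵥ (S.chain x s D k).1 - p * (S.chain x s D k).2
    + ∑ j ∈ Finset.range k, scaledSize (s (j + 1) - s j) (fun i => D j (some i)) (D j none))

lemma chainWeight_zero (η : Fin d → ℝ) (p : ℝ) (x : Fin d → ℝ) (s : ℕ → ℝ)
    (D : ℕ → Option (Fin m) → ℝ) : S.chainWeight η p x s D 0 = Real.exp (η ⬝ᵥ x) := by
  simp [chainWeight, chain]

lemma chainWeight_succ (η : Fin d → ℝ) (p : ℝ) (x : Fin d → ℝ) (s : ℕ → ℝ)
    (D : ℕ → Option (Fin m) → ℝ) (k : ℕ) :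
    S.chainWeight η p x s D (k + 1) = S.chainWeight η p x s D k
      * S.stepWeight η p (S.chain x s D k) (s (k + 1) - s k) (D k) := by
  rw [chainWeight, chainWeight, stepWeight, ← Real.exp_add, Finset.sum_range_succ]
  congr 1
  simp only [chain, eulerStep, dotProduct_add]
  ring

/-- Adaptedness: the state after k steps reads only the first k increments, as the independence
argument requires. -/
lemma chain_congr {x : Fin d → ℝ} {s s' : ℕ → ℝ} {D D' : ℕ → Option (Fin m) → ℝ} {k : ℕ}
    (hs : ∀ j ≤ k, s j = s' j) (hD : ∀ j < k, D j = D' j) :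
    S.chain x s D k = S.chain x s' D' k := by
  induction k with
  | zero => rfl
  | succ k ih =>
    rw [chain, chain, ih (fun j hj => hs j (by omega)) (fun j hj => hD j (by omega)),
      hs k (by omega),
      hs (k + 1) le_rfl, hD k (by omega)]

lemma chainWeight_congr {η : Fin d → ℝ} {p : ℝ} {x : Fin d → ℝ} {s : ℕ → ℝ}
    {D D' : ℕ → Option (Fin m) → ℝ} {k : ℕ} (hD : ∀ j < k, D j = D' j) :
    S.chainWeight η p x s D k = S.chainWeight η p x s D' k := by
  rw [chainWeight, chainWeight, chain_congr (fun _ _ => rfl) hD]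
  congr 2
  exact Finset.sum_congr rfl fun j hj => by rw [hD j (Finset.mem_range.mp hj)]

section Measurability

variable {α : Type*} [MeasurableSpace α]

lemma IsAdmissible.measurable_mu (hS : S.IsAdmissible a₁ a₂ lam₁ lam₂) : Measurable S.mu :=
  hS.mu_reg.1.continuous.measurable

lemma IsAdmissible.measurable_lam (hS : S.IsAdmissible a₁ a₂ lam₁ lam₂) : Measurable S.lam :=
  hS.lam_reg.continuous.measurable

lemma IsAdmissible.measurable_sigma_mulVec (hS : S.IsAdmissible a₁ a₂ lam₁ lam₂)
    {y : α → Fin d → ℝ} {w : α → Fin m → ℝ} (hy : Measurable y)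
    (hw : ∀ i, Measurable fun a => w a i) :
    Measurable fun a => S.sigma (y a) *ᵥ w a := by
  refine measurable_pi_lambda _ fun i => ?_
  simp only [Matrix.mulVec, dotProduct]
  exact Finset.measurable_sum _ fun k _ => ((hS.sigma_meas i k).comp hy).mul (hw k)

lemma measurable_scaledSize {t : α → ℝ} {w : α → Fin m → ℝ} {wb : α → ℝ} (ht : Measurable t)
    (hw : ∀ i, Measurable fun a => w a i) (hwb : Measurable wb) :
    Measurable fun a => scaledSize (t a) (w a) (wb a) := by
  unfold scaledSize
  exact ((Finset.measurable_sum _ fun k _ => (hw k).abs).add hwb.abs).div ht.sqrt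

lemma IsAdmissible.measurable_stepWeight (hS : S.IsAdmissible a₁ a₂ lam₁ lam₂) (η : Fin d → ℝ)
    (p : ℝ) {z : α → (Fin d → ℝ) × ℝ} {t : α → ℝ} {D : α → Option (Fin m) → ℝ}
    (hz : Measurable z) (ht : Measurable t) (hD : ∀ o, Measurable fun a => D a o) :
    Measurable fun a => S.stepWeight η p (z a) (t a) (D a) := by
  have h1 : Measurable fun a => t a • S.mu (z a).1 + S.sigma (z a).1 *ᵥ fun i => D a (some i) :=
    (ht.smul (hS.measurable_mu.comp hz.fst)).add
      (hS.measurable_sigma_mulVec hz.fst fun i => hD (some i))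
  have h2 : Measurable fun a =>
      η ⬝ᵥ (t a • S.mu (z a).1 + S.sigma (z a).1 *ᵥ fun i => D a (some i)) := by
    simp only [dotProduct]
    exact Finset.measurable_sum _ fun i _ => ((measurable_pi_apply i).comp h1).const_mul _
  exact ((h2.sub ((((hS.measurable_lam.comp hz.fst).mul ht).add
    ((hD none).const_mul _)).const_mul _)).add
      (measurable_scaledSize ht (fun i => hD (some i)) (hD none))).exp

lemma IsAdmissible.measurable_chain (hS : S.IsAdmissible a₁ a₂ lam₁ lam₂) (x : Fin d → ℝ)
    {s : α → ℕ → ℝ} {D : α → ℕ → Option (Fin m) → ℝ} (hs : ∀ k, Measurable fun a => s a k)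
    (hD : ∀ k o, Measurable fun a => D a k o) (k : ℕ) :
    Measurable fun a => S.chain x (s a) (D a) k := by
  induction k with
  | zero => exact measurable_const
  | succ k ih =>
    have ht : Measurable fun a => s a (k + 1) - s a k := (hs (k + 1)).sub (hs k)
    exact ((ih.fst.add (ht.smul (hS.measurable_mu.comp ih.fst))).add
      (hS.measurable_sigma_mulVec ih.fst fun i => hD k (some i))).prodMk
      ((ih.snd.add ((hS.measurable_lam.comp ih.fst).mul ht)).add ((hD k none).const_mul _))

lemma IsAdmissible.measurable_chainWeight (hS : S.IsAdmissible a₁ a₂ lam₁ lam₂) (η : Fin d → ℝ)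
    (p : ℝ) (x : Fin d → ℝ)
    {s : α → ℕ → ℝ} {D : α → ℕ → Option (Fin m) → ℝ} (hs : ∀ k, Measurable fun a => s a k)
    (hD : ∀ k o, Measurable fun a => D a k o) (k : ℕ) :
    Measurable fun a => S.chainWeight η p x (s a) (D a) k := by
  induction k with
  | zero => simp only [chainWeight_zero]; exact measurable_const
  | succ k ih =>
    simp only [chainWeight_succ]
    exact ih.mul (hS.measurable_stepWeight η p (hS.measurable_chain x hs hD k)
      ((hs (k + 1)).sub (hs k)) (hD k))

end Measurability

/-- Exponential moment of the Euler chain along a deterministic grid. -/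
lemma IsAdmissible.lintegral_chainWeight_le (hS : S.IsAdmissible a₁ a₂ lam₁ lam₂) {Kmu : ℝ}
    (hmu : ∀ y, ‖S.mu y‖ ≤ Kmu) (η : Fin d → ℝ) {p : ℝ} (hp : 0 ≤ p) (x : Fin d → ℝ)
    {Ω : Type*} [MeasurableSpace Ω] {P : Measure Ω} [IsProbabilityMeasure P] {s : ℕ → ℝ}
    (hs : Monotone s) {D : ℕ → Option (Fin m) → Ω → ℝ} (hD : ∀ k o, Measurable (D k o))
    (hlaw : ∀ k o, P.map (D k o) = gaussianReal 0 (s (k + 1) - s k).toNNReal)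
    (hind : iIndepFun (fun (q : Option (Fin m) × ℕ) => D q.2 q.1) P) (k : ℕ) :
    ∫⁻ ω, ENNReal.ofReal (S.chainWeight η p x s (fun j o => D j o ω) k) ∂P
      ≤ ENNReal.ofReal (Real.exp (η ⬝ᵥ x) * (((2 * Real.exp 1) ^ (m + 1)) ^ k
        * Real.exp (S.stepRate a₂ Kmu η p * (s k - s 0)))) := by
  induction k with
  | zero => simp [chainWeight_zero]
  | succ k ih =>
    have hgap : 0 ≤ s (k + 1) - s k := sub_nonneg.mpr (hs (Nat.le_succ k))
    have hev : ∀ j o, Measurable fun a : ℕ → Option (Fin m) → ℝ => a j o := fun j o =>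
      (measurable_pi_apply o).comp (measurable_pi_apply j)
    have hstep : ∀ z, ∫⁻ ω, ENNReal.ofReal (S.stepWeight η p z (s (k + 1) - s k) fun o => D k o ω) ∂P
        ≤ ENNReal.ofReal ((2 * Real.exp 1) ^ (m + 1)
          * Real.exp (S.stepRate a₂ Kmu η p * (s (k + 1) - s k))) := fun z => by
      have := hS.lintegral_stepWeight_le hmu η hp (t := (s (k + 1) - s k).toNNReal)
        (hD k) (hlaw k) (hind.precomp (g := fun o => (o, k)) fun a b h => (Prod.mk.inj h).1) z
      rwa [Real.coe_toNNReal _ hgap] at this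
    have hFm : Measurable fun a : ℕ → Option (Fin m) → ℝ =>
        ENNReal.ofReal (S.chainWeight η p x s a k) :=
      (hS.measurable_chainWeight η p x (s := fun _ => s) (fun _ => measurable_const) hev
        k).ennreal_ofReal
    have hcm : Measurable fun a : ℕ → Option (Fin m) → ℝ => S.chain x s a k :=
      hS.measurable_chain x (s := fun _ => s) (fun _ => measurable_const) hev k
    have hgm : Measurable (Function.uncurry fun (a : ℕ → Option (Fin m) → ℝ) b =>
        ENNReal.ofReal (S.stepWeight η p (S.chain x s a k) (s (k + 1) - s k) b)) :=
      (hS.measurable_stepWeight η p (t := fun _ => s (k + 1) - s k)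
        (z := fun q : (ℕ → Option (Fin m) → ℝ) × (Option (Fin m) → ℝ) => S.chain x s q.1 k)
        (D := fun q : (ℕ → Option (Fin m) → ℝ) × (Option (Fin m) → ℝ) => q.2)
        (hcm.comp measurable_fst) measurable_const
        fun o => (measurable_pi_apply o).comp measurable_snd).ennreal_ofReal
    calc _ = ∫⁻ ω, ENNReal.ofReal (S.chainWeight η p x s (fun j o => D j o ω) k)
          * ENNReal.ofReal (S.stepWeight η p (S.chain x s (fun j o => D j o ω) k)
            (s (k + 1) - s k) (fun o => D k o ω)) ∂P := by
          refine lintegral_congr fun ω => ?_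
          rw [← ENNReal.ofReal_mul (by unfold chainWeight; positivity), chainWeight_succ]
      _ ≤ ENNReal.ofReal ((2 * Real.exp 1) ^ (m + 1)
          * Real.exp (S.stepRate a₂ Kmu η p * (s (k + 1) - s k)))
          * ∫⁻ ω, ENNReal.ofReal (S.chainWeight η p x s (fun j o => D j o ω) k) ∂P :=
          lintegral_mul_le_of_iIndepFun hD hind k
            hFm hgm
            (fun a b h => by rw [chainWeight_congr h])
            (fun a b h => by rw [chain_congr (fun _ _ => rfl) h])
            fun a => hstep _
      _ ≤ ENNReal.ofReal ((2 * Real.exp 1) ^ (m + 1)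
          * Real.exp (S.stepRate a₂ Kmu η p * (s (k + 1) - s k)))
          * ENNReal.ofReal (Real.exp (η ⬝ᵥ x) * (((2 * Real.exp 1) ^ (m + 1)) ^ k
            * Real.exp (S.stepRate a₂ Kmu η p * (s k - s 0)))) := by
          gcongr
      _ = _ := by
          rw [← ENNReal.ofReal_mul (by positivity)]
          congr 1
          have : S.stepRate a₂ Kmu η p * (s (k + 1) - s 0)
              = S.stepRate a₂ Kmu η p * (s (k + 1) - s k)
                + S.stepRate a₂ Kmu η p * (s k - s 0) := by ring
          rw [this, Real.exp_add, pow_succ]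
          ring

end Model

/-! ### Evaluating paths at random times -/

/-- A jointly measurable version of path evaluation, equal to `f t` when `f` is continuous. -/
def evalLim (t : ℝ≥0) (f : ℝ≥0 → ℝ) : ℝ :=
  Filter.limsup (fun r : ℕ => f ((⌊(t : ℝ) * r⌋₊ : ℝ≥0) / r)) Filter.atTop

/-- Each approximation evaluates the path in the countable set of multiples of 1/r, hence is jointly
measurable. Evaluation of arbitrary paths at a variable time is not jointly measurable for the
product σ-algebra. -/
lemma measurable_evalLim : Measurable fun q : ℝ≥0 × (ℝ≥0 → ℝ) => evalLim q.1 q.2 := by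
  refine Measurable.limsup fun r => ?_
  have h : Measurable fun q : ℕ × (ℝ≥0 → ℝ) => q.2 ((q.1 : ℝ≥0) / r) :=
    measurable_from_prod_countable_right fun n => measurable_pi_apply ((n : ℝ≥0) / r)
  have h2 : Measurable fun q : ℝ≥0 × (ℝ≥0 → ℝ) => ⌊(q.1 : ℝ) * r⌋₊ :=
    Nat.measurable_floor.comp (measurable_fst.coe_nnreal_real.mul_const _)
  exact h.comp (h2.prodMk measurable_snd)

lemma evalLim_eq {f : ℝ≥0 → ℝ} (hf : Continuous f) (t : ℝ≥0) : evalLim t f = f t := by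
  refine Filter.Tendsto.limsup_eq ((hf.tendsto t).comp ?_)
  rw [← NNReal.tendsto_coe]
  have := (tendsto_nat_floor_mul_div_atTop t.coe_nonneg).comp tendsto_natCast_atTop_atTop
  refine this.congr fun r => ?_
  simp

attribute [irreducible] evalLim

lemma measurable_evalLim_comp {α : Type*} [MeasurableSpace α] {t : α → ℝ≥0} {f : α → ℝ≥0 → ℝ}
    (ht : Measurable t) (hf : Measurable f) : Measurable fun a => evalLim (t a) (f a) :=
  measurable_evalLim.comp (g := fun q : ℝ≥0 × (ℝ≥0 → ℝ) => evalLim q.1 q.2) (ht.prodMk hf)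

/-- The component of index `o` of a path of `(W, Wbar)`. -/
def noisePath {m : ℕ} (v : (Fin m → ℝ≥0 → ℝ) × (ℝ≥0 → ℝ)) : Option (Fin m) → ℝ≥0 → ℝ
  | none => v.2
  | some i => v.1 i

lemma measurable_noisePath {m : ℕ} (o : Option (Fin m)) :
    Measurable fun v : (Fin m → ℝ≥0 → ℝ) × (ℝ≥0 → ℝ) => noisePath v o := by
  cases o with
  | none => exact measurable_snd
  | some i => exact (measurable_pi_apply i).comp measurable_fst

/-- Boxes determine a law on a finite product, and on boxes the two independence hypotheses give the
product formula. -/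
lemma iIndepFun_option {ι Ω β : Type*} [Fintype ι] [MeasurableSpace Ω] [MeasurableSpace β]
    {P : Measure Ω} [IsProbabilityMeasure P] {X : Option ι → Ω → β}
    (hX : ∀ o, Measurable (X o))
    (hs : iIndepFun (fun i => X (some i)) P)
    (hn : IndepFun (fun ω i => X (some i) ω) (X none) P) : iIndepFun X P := by
  have : ∀ o, IsProbabilityMeasure (P.map (X o)) := fun o =>
    Measure.isProbabilityMeasure_map (hX o).aemeasurable
  rw [iIndepFun_iff_map_fun_eq_pi_map fun o => (hX o).aemeasurable]
  symm
  refine Measure.pi_eq fun s hs' => ?_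
  have hXm : Measurable fun ω o => X o ω := measurable_pi_lambda _ hX
  rw [Measure.map_apply hXm (MeasurableSet.univ_pi hs'), Fintype.prod_option]
  have h1 : (fun ω o => X o ω) ⁻¹' (Set.univ.pi s)
      = (fun ω i => X (some i) ω) ⁻¹' (Set.univ.pi fun i => s (some i)) ∩ X none ⁻¹' (s none) := by
    ext ω
    simp only [Set.mem_preimage, Set.mem_pi, Set.mem_univ, true_implies, Set.mem_inter_iff,
      Option.forall]
    exact and_comm
  have h2 : (fun ω i => X (some i) ω) ⁻¹' (Set.univ.pi fun i => s (some i))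
      = ⋂ i, X (some i) ⁻¹' s (some i) := by
    ext ω; simp [Set.mem_pi]
  rw [h1, hn.measure_inter_preimage_eq_mul _ _ (MeasurableSet.univ_pi fun i => hs' _) (hs' _), h2,
    mul_comm, Measure.map_apply (hX none) (hs' _)]
  congr 1
  have h3 := hs.measure_inter_preimage_eq_mul Finset.univ (sets := fun i => s (some i))
    fun i _ => hs' _
  simp only [Finset.mem_univ, Set.iInter_true] at h3
  rw [h3]
  exact Finset.prod_congr rfl fun i _ => (Measure.map_apply (hX _) (hs' _)).symm

/-! ### Joint law of the Brownian increments. -/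

namespace Inputs

variable {d m : ℕ} {Ω : Type u} {I : Inputs m Ω} [MeasurableSpace Ω] {G : Grid} {P : Measure Ω}

/-- The paths of `(W, Wbar)`. -/
def noise {Ω : Type*} (I : Inputs m Ω) (ω : Ω) : (Fin m → ℝ≥0 → ℝ) × (ℝ≥0 → ℝ) :=
  (fun i t => I.W i t ω, fun t => I.Wbar t ω)

/-- The Brownian motions `Wbar` and `W i`, as one family. -/
def brownian {Ω : Type*} (I : Inputs m Ω) (o : Option (Fin m)) (t : ℝ≥0) (ω : Ω) : ℝ :=
  noisePath (I.noise ω) o t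

lemma HasStandardLaw.measurable_noise (hI : I.HasStandardLaw G P) : Measurable I.noise :=
  (measurable_pi_lambda _ fun i => measurable_pi_lambda _ fun t => hI.W_meas i t).prodMk
    (measurable_pi_lambda _ fun t => hI.Wbar_meas t)

lemma HasStandardLaw.isBrownianReal (hI : I.HasStandardLaw G P) (o : Option (Fin m)) :
    IsBrownianReal (I.brownian o) P := by
  cases o with
  | none => exact hI.Wbar_brownian
  | some i => exact hI.W_brownian i

lemma HasStandardLaw.measurable_brownian (hI : I.HasStandardLaw G P) (o : Option (Fin m))
    (t : ℝ≥0) : Measurable (I.brownian o t) := by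
  cases o with
  | none => exact hI.Wbar_meas t
  | some i => exact hI.W_meas i t

lemma HasStandardLaw.iIndepFun_brownian [IsProbabilityMeasure P] (hI : I.HasStandardLaw G P) :
    iIndepFun (fun o ω t => I.brownian o t ω) P :=
  iIndepFun_option (fun o => measurable_pi_lambda _ fun t => hI.measurable_brownian o t)
    hI.W_indep hI.W_indep_Wbar

lemma HasStandardLaw.ae_continuous (hI : I.HasStandardLaw G P) :
    ∀ᵐ ω ∂P, ∀ o, Continuous fun t => I.brownian o t ω :=
  ae_all_iff.mpr fun o => (hI.isBrownianReal o).cont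

/-- Independence over time comes from each Brownian motion separately, independence over components
from that of the whole paths. -/
lemma HasStandardLaw.iIndepFun_increments [IsProbabilityMeasure P] (hI : I.HasStandardLaw G P)
    {t : ℕ → ℝ≥0} (ht : Monotone t) :
    iIndepFun (fun (q : Option (Fin m) × ℕ) ω =>
      I.brownian q.1 (t (q.2 + 1)) ω - I.brownian q.1 (t q.2) ω) P := by
  refine iIndepFun_uncurry' (X := fun o k ω => I.brownian o (t (k + 1)) ω - I.brownian o (t k) ω)
    (fun o k => (hI.measurable_brownian o _).sub (hI.measurable_brownian o _)) ?_
    fun o => (hI.isBrownianReal o).hasIndepIncrements.nat ht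
  exact hI.iIndepFun_brownian.comp (fun _ f k => f (t (k + 1)) - f (t k)) fun _ =>
    measurable_pi_lambda _ fun k => (measurable_pi_apply _).sub (measurable_pi_apply _)

lemma HasStandardLaw.map_increment (hI : I.HasStandardLaw G P) (o : Option (Fin m)) {a b : ℝ}
    (ha : 0 ≤ a) (hab : a ≤ b) :
    P.map (fun ω => I.brownian o b.toNNReal ω - I.brownian o a.toNNReal ω)
      = gaussianReal 0 (b - a).toNNReal := by
  have h := ((hI.isBrownianReal o).hasLaw_sub b.toNNReal a.toNNReal).map_eq
  have h2 : nndist b.toNNReal.1 a.toNNReal.1 = (b - a).toNNReal := by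
    apply NNReal.eq
    change (nndist (b.toNNReal : ℝ) (a.toNNReal : ℝ) : ℝ) = ((b - a).toNNReal : ℝ)
    rw [Real.coe_toNNReal _ ha, Real.coe_toNNReal _ (ha.trans hab), coe_nndist,
      Real.coe_toNNReal _ (sub_nonneg.mpr hab), Real.dist_eq, abs_of_nonneg (sub_nonneg.mpr hab)]
  rw [h2] at h
  exact h

end Inputs

/-! ### The grid with `n` arrivals -/

/-- The arrival times with interarrival times `u`. -/
def arrival (u : ℕ → ℝ) (k : ℕ) : ℝ := ∑ j ∈ Finset.range k, u j

/-- The first `n` arrival times, followed by the horizon `T`. -/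
def stoppedGrid (T : ℝ) (n : ℕ) (u : ℕ → ℝ) (k : ℕ) : ℝ := if k ≤ n then arrival u k else T

/-- The Brownian increments along `stoppedGrid`. -/
def gridIncrement {m : ℕ} (T : ℝ) (n : ℕ) (u : ℕ → ℝ) (v : (Fin m → ℝ≥0 → ℝ) × (ℝ≥0 → ℝ)) (k : ℕ)
    (o : Option (Fin m)) : ℝ :=
  evalLim (stoppedGrid T n u (k + 1)).toNNReal (noisePath v o)
    - evalLim (stoppedGrid T n u k).toNNReal (noisePath v o)

/-- The interarrival times for which there are at least `n` arrivals until `T`. -/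
def arrivalsBefore (T : ℝ) (n : ℕ) : Set (ℕ → ℝ) := {u | (∀ k < n, 0 < u k) ∧ arrival u n ≤ T}

lemma measurable_arrival (k : ℕ) : Measurable fun u : ℕ → ℝ => arrival u k :=
  Finset.measurable_sum _ fun j _ => measurable_pi_apply j

lemma measurable_stoppedGrid (T : ℝ) (n k : ℕ) :
    Measurable fun u : ℕ → ℝ => stoppedGrid T n u k := by
  unfold stoppedGrid
  split_ifs
  · exact measurable_arrival k
  · exact measurable_const

lemma measurable_gridIncrement {m : ℕ} (T : ℝ) (n k : ℕ) (o : Option (Fin m)) :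
    Measurable fun q : (ℕ → ℝ) × ((Fin m → ℝ≥0 → ℝ) × (ℝ≥0 → ℝ)) =>
      gridIncrement T n q.1 q.2 k o := by
  have h : ∀ j, Measurable fun q : (ℕ → ℝ) × ((Fin m → ℝ≥0 → ℝ) × (ℝ≥0 → ℝ)) =>
      evalLim (stoppedGrid T n q.1 j).toNNReal (noisePath q.2 o) := fun j => by
    have h1 : Measurable fun q : (ℕ → ℝ) × ((Fin m → ℝ≥0 → ℝ) × (ℝ≥0 → ℝ)) =>
        (stoppedGrid T n q.1 j).toNNReal :=
      ((measurable_stoppedGrid T n j).comp measurable_fst).real_toNNReal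
    have h2 : Measurable fun q : (ℕ → ℝ) × ((Fin m → ℝ≥0 → ℝ) × (ℝ≥0 → ℝ)) =>
        noisePath q.2 o := (measurable_noisePath o).comp measurable_snd
    exact measurable_evalLim_comp h1 h2
  exact (h (k + 1)).sub (h k)

lemma measurableSet_arrivalsBefore (T : ℝ) (n : ℕ) : MeasurableSet (arrivalsBefore T n) := by
  have h1 : MeasurableSet (⋂ k : ℕ, ⋂ _ : k < n, {u : ℕ → ℝ | 0 < u k}) :=
    MeasurableSet.iInter fun k => MeasurableSet.iInter fun _ =>
      measurableSet_lt measurable_const (measurable_pi_apply k)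
  convert h1.inter (measurableSet_le (measurable_arrival n) (measurable_const (a := T))) using 1
  ext u; simp [arrivalsBefore]

lemma monotone_stoppedGrid {T : ℝ} {n : ℕ} {u : ℕ → ℝ} (hu : u ∈ arrivalsBefore T n) :
    Monotone (stoppedGrid T n u) := by
  refine monotone_nat_of_le_succ fun k => ?_
  unfold stoppedGrid
  rcases lt_trichotomy k n with h | h | h
  · rw [if_pos h.le, if_pos (Nat.succ_le_of_lt h), arrival, arrival, Finset.sum_range_succ]
    linarith [hu.1 k h]
  · subst h
    simpa using hu.2
  · rw [if_neg (by omega), if_neg (by omega)]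

lemma stoppedGrid_zero (T : ℝ) (n : ℕ) (u : ℕ → ℝ) : stoppedGrid T n u 0 = 0 := by
  simp [stoppedGrid, arrival]

lemma stoppedGrid_nonneg {T : ℝ} {n : ℕ} {u : ℕ → ℝ} (hu : u ∈ arrivalsBefore T n) (k : ℕ) :
    0 ≤ stoppedGrid T n u k := by
  rw [← stoppedGrid_zero T n u]
  exact monotone_stoppedGrid hu (Nat.zero_le k)

lemma stoppedGrid_last (T : ℝ) (n : ℕ) (u : ℕ → ℝ) : stoppedGrid T n u (n + 1) = T := by
  simp [stoppedGrid]

/-! ### Averaging over the noise for a random grid. -/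

namespace Model

variable {d m : ℕ} {S : Model d m} {a₁ a₂ lam₁ lam₂ : ℝ}

/-- The weighted contribution of the event of at least `n` arrivals before `T`, where each arrival
after a waiting time `t` contributes a factor `r t`. -/
def gridWeight (S : Model d m) (r : ℝ → ℝ) (T : ℝ) (η : Fin d → ℝ) (p : ℝ) (x : Fin d → ℝ) (n : ℕ)
    (u : ℕ → ℝ) (v : (Fin m → ℝ≥0 → ℝ) × (ℝ≥0 → ℝ)) : ℝ≥0∞ :=
  (arrivalsBefore T n).indicator (fun u => ∏ k ∈ Finset.range n, ENNReal.ofReal (r (u k))) u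
    * ENNReal.ofReal
      (S.chainWeight η p x (stoppedGrid T n u) (gridIncrement T n u v) (n + 1))

lemma IsAdmissible.measurable_grid_chainWeight (hS : S.IsAdmissible a₁ a₂ lam₁ lam₂) (T : ℝ)
    (η : Fin d → ℝ) (p : ℝ) (x : Fin d → ℝ) (n k : ℕ) :
    Measurable fun q : (ℕ → ℝ) × ((Fin m → ℝ≥0 → ℝ) × (ℝ≥0 → ℝ)) =>
      S.chainWeight η p x (stoppedGrid T n q.1) (gridIncrement T n q.1 q.2) k := by
  have hs : ∀ j, Measurable fun q : (ℕ → ℝ) × ((Fin m → ℝ≥0 → ℝ) × (ℝ≥0 → ℝ)) =>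
      stoppedGrid T n q.1 j := fun j => (measurable_stoppedGrid T n j).comp measurable_fst
  have hD := fun j o => measurable_gridIncrement (m := m) T n j o
  exact hS.measurable_chainWeight η p x hs hD k

lemma IsAdmissible.measurable_gridWeight (hS : S.IsAdmissible a₁ a₂ lam₁ lam₂) {r : ℝ → ℝ}
    (hr : Measurable r) (T : ℝ) (η : Fin d → ℝ) (p : ℝ) (x : Fin d → ℝ) (n : ℕ) :
    Measurable (Function.uncurry (S.gridWeight r T η p x n)) := by
  have h1 : Measurable fun u : ℕ → ℝ => ∏ k ∈ Finset.range n, ENNReal.ofReal (r (u k)) :=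
    Finset.measurable_prod _ fun k _ => (hr.comp (measurable_pi_apply k)).ennreal_ofReal
  have h2 := hS.measurable_grid_chainWeight T η p x n (n + 1)
  have h3 : Measurable fun q : (ℕ → ℝ) × ((Fin m → ℝ≥0 → ℝ) × (ℝ≥0 → ℝ)) =>
      (arrivalsBefore T n).indicator (fun u => ∏ k ∈ Finset.range n, ENNReal.ofReal (r (u k))) q.1 :=
    (h1.indicator (measurableSet_arrivalsBefore T n)).comp
      (g := (arrivalsBefore T n).indicator fun u => ∏ k ∈ Finset.range n, ENNReal.ofReal (r (u k)))
      measurable_fst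
  have h4 := h3.mul h2.ennreal_ofReal
  simpa only [Function.uncurry_def, gridWeight, Pi.mul_def] using h4

/-- The waiting times are independent of the noise and can be frozen. The deterministic estimate
then applies with n + 1 steps, the last one leading from the n-th arrival to T. -/
lemma IsAdmissible.lintegral_gridWeight_le (hS : S.IsAdmissible a₁ a₂ lam₁ lam₂) {Kmu : ℝ}
    (hmu : ∀ y, ‖S.mu y‖ ≤ Kmu) {r : ℝ → ℝ} (hr : Measurable r) (T : ℝ)
    (η : Fin d → ℝ) {p : ℝ} (hp : 0 ≤ p) (x : Fin d → ℝ)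
    {Ω : Type u} [MeasurableSpace Ω] {P : Measure Ω} [IsProbabilityMeasure P] {I : Inputs m Ω}
    {G : Grid} (hI : I.HasStandardLaw G P) (n : ℕ) :
    ∫⁻ ω, S.gridWeight r T η p x n (fun k => I.xi k ω) (I.noise ω) ∂P
      ≤ ENNReal.ofReal (Real.exp (η ⬝ᵥ x) * (((2 * Real.exp 1) ^ (m + 1)) ^ (n + 1)
        * Real.exp (S.stepRate a₂ Kmu η p * T)))
        * ∫⁻ ω, (arrivalsBefore T n).indicator
          (fun u => ∏ k ∈ Finset.range n, ENNReal.ofReal (r (u k))) (fun k => I.xi k ω) ∂P := by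
  have hξ : Measurable fun ω k => I.xi k ω := measurable_pi_lambda _ hI.xi_meas
  rw [lintegral_comp_prodMk_of_indepFun hξ hI.measurable_noise hI.xi_indep_W
    (hS.measurable_gridWeight hr T η p x n), ← lintegral_const_mul']
  swap
  · exact ENNReal.ofReal_ne_top
  refine lintegral_mono fun ω => ?_
  set u : ℕ → ℝ := fun k => I.xi k ω with hu
  by_cases hmem : u ∈ arrivalsBefore T n
  swap
  · simp [gridWeight, Set.indicator_of_notMem hmem]
  simp only [gridWeight]
  rw [lintegral_const_mul', mul_comm]
  swap
  · rw [Set.indicator_of_mem hmem]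
    exact ENNReal.prod_ne_top fun _ _ => ENNReal.ofReal_ne_top
  gcongr
  have hmono := monotone_stoppedGrid hmem
  have h0 := stoppedGrid_nonneg hmem
  have key := hS.lintegral_chainWeight_le hmu η hp x (P := P) hmono
    (D := fun k o ω => I.brownian o (stoppedGrid T n u (k + 1)).toNNReal ω
      - I.brownian o (stoppedGrid T n u k).toNNReal ω)
    (fun k o => (hI.measurable_brownian o _).sub (hI.measurable_brownian o _))
    (fun k o => hI.map_increment o (h0 k) (hmono (Nat.le_succ k)))
    (hI.iIndepFun_increments (t := fun k => (stoppedGrid T n u k).toNNReal)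
      fun a b h => Real.toNNReal_le_toNNReal (hmono h)) (n + 1)
  rw [stoppedGrid_last, stoppedGrid_zero, sub_zero] at key
  refine le_of_eq_of_le (lintegral_congr_ae ?_) key
  filter_upwards [hI.ae_continuous] with ω' hω'
  congr 2
  funext k o
  have hc : Continuous (noisePath (I.noise ω') o) := hω' o
  simp only [gridIncrement, Inputs.brownian]
  rw [evalLim_eq hc, evalLim_eq hc]

end Model

/-! ### The interarrival law -/

namespace Grid

variable {G : Grid}

lemma IsValid.horizon_pos (hG : G.IsValid) : 0 < G.T + G.ε := add_pos hG.T_pos hG.ε_pos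

lemma IsValid.psi_const_pos (hG : G.IsValid) : 0 < (1 - G.γ) / (G.T + G.ε) ^ (1 - G.γ) :=
  div_pos (by linarith [hG.γ_lt_one]) (Real.rpow_pos_of_pos hG.horizon_pos _)

lemma psi_eq_of_mem {t : ℝ} (ht : t ∈ Set.Ioc 0 (G.T + G.ε)) :
    G.psi t = (1 - G.γ) / (G.T + G.ε) ^ (1 - G.γ) * t ^ (-G.γ) := by
  rw [psi, if_pos (Set.mem_Ioc.mp ht), Real.rpow_neg ht.1.le]
  field_simp

lemma psi_eq_indicator : G.psi = (Set.Ioc 0 (G.T + G.ε)).indicator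
    fun t => (1 - G.γ) / (G.T + G.ε) ^ (1 - G.γ) * t ^ (-G.γ) := by
  funext t
  by_cases ht : t ∈ Set.Ioc 0 (G.T + G.ε)
  · rw [Set.indicator_of_mem ht, psi_eq_of_mem ht]
  · rw [Set.indicator_of_notMem ht, psi, if_neg fun h => ht (Set.mem_Ioc.mpr h)]

lemma IsValid.psi_nonneg (hG : G.IsValid) (t : ℝ) : 0 ≤ G.psi t := by
  rw [psi_eq_indicator]
  exact Set.indicator_nonneg (fun t ht => mul_nonneg hG.psi_const_pos.le
    (Real.rpow_nonneg ht.1.le _)) t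

lemma measurable_psi : Measurable G.psi := by
  rw [psi_eq_indicator]
  exact ((measurable_id.pow_const _).const_mul _).indicator measurableSet_Ioc

lemma IsValid.integrable_psi (hG : G.IsValid) : Integrable G.psi := by
  rw [psi_eq_indicator, integrable_indicator_iff measurableSet_Ioc]
  refine Integrable.const_mul ?_ _
  have := intervalIntegral.intervalIntegrable_rpow' (a := 0) (b := G.T + G.ε) (r := -G.γ)
    (by linarith [hG.γ_lt_one])
  exact (intervalIntegrable_iff_integrableOn_Ioc_of_le hG.horizon_pos.le).mp this

lemma IsValid.survival_anti (hG : G.IsValid) {s t : ℝ} (hst : s ≤ t) :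
    G.survival t ≤ G.survival s :=
  setIntegral_mono_set hG.integrable_psi.integrableOn
    (Filter.Eventually.of_forall fun t => hG.psi_nonneg t)
    (Set.Ioi_subset_Ioi hst).eventuallyLE

/-- Since ε > 0, ψ has mass on (T, T + ε]. By monotonicity 1/Ψ(T) then bounds the prefactor of Θ₂.
-/
lemma IsValid.survival_pos (hG : G.IsValid) : 0 < G.survival G.T := by
  rw [survival, setIntegral_pos_iff_support_of_nonneg_ae
    (Filter.Eventually.of_forall fun t => hG.psi_nonneg t) hG.integrable_psi.integrableOn]
  refine lt_of_lt_of_le ?_ (measure_mono (s := Set.Ioc G.T (G.T + G.ε)) fun t ht => ⟨?_, ht.1⟩)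
  · simp [hG.ε_pos]
  · have ht0 : 0 < t := hG.T_pos.trans ht.1
    rw [Function.mem_support, psi_eq_of_mem ⟨ht0, ht.2⟩]
    exact (mul_pos hG.psi_const_pos (Real.rpow_pos_of_pos ht0 _)).ne'

end Grid

lemma Inputs.HasStandardLaw.ae_xi_pos {m : ℕ} {Ω : Type u} [MeasurableSpace Ω] {I : Inputs m Ω}
    {G : Grid} {P : Measure Ω} (hI : I.HasStandardLaw G P) : ∀ᵐ ω ∂P, ∀ k, 0 < I.xi k ω := by
  refine ae_all_iff.mpr fun k => ?_
  have h : ∀ᵐ t ∂(P.map (I.xi k)), 0 < t := by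
    rw [hI.xi_law k, Grid.arrivalLaw, ae_withDensity_iff Grid.measurable_psi.ennreal_ofReal]
    refine Filter.Eventually.of_forall fun t ht => ?_
    by_contra h
    apply ht
    rw [Grid.psi, if_neg fun hh => h hh.1, ENNReal.ofReal_zero]
  exact ae_of_ae_map (hI.xi_meas k).aemeasurable h

/-! ### Pointwise domination of the integrand -/

/-- The vector with entries `±c`, with signs given by `e`. -/
def signVec {d : ℕ} (c : ℝ) (e : Fin d → Bool) (i : Fin d) : ℝ := if e i then c else -c

/-- Expansion of ∏ (e^(c y_i) + e^(-c y_i)). The sign vectors replace the ℓ¹ norm by linear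
functionals, to which the exponential moment bound applies; at the starting point their sum gives
the hyperbolic cosines. -/
lemma sum_exp_signVec {d : ℕ} (c : ℝ) (y : Fin d → ℝ) :
    ∑ e, Real.exp (signVec c e ⬝ᵥ y) = 2 ^ d * ∏ i, Real.cosh (c * y i) := by
  have h1 : ∀ e, Real.exp (signVec c e ⬝ᵥ y)
      = ∏ i, Real.exp ((if e i then c else -c) * y i) := fun e => by
    rw [← Real.exp_sum]; rfl
  have h2 := Finset.prod_univ_sum (fun _ : Fin d => (Finset.univ : Finset Bool))
    (fun i b => Real.exp ((if b then c else -c) * y i))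
  rw [Fintype.piFinset_univ] at h2
  simp only [h1]
  rw [← h2]
  have h3 : ∀ i, ∑ b : Bool, Real.exp ((if b then c else -c) * y i)
      = 2 * Real.cosh (c * y i) := fun i => by
    rw [Fintype.sum_bool, Real.cosh_eq]
    simp only [if_true, Bool.false_eq_true, if_false, neg_mul]
    ring
  simp only [h3]
  rw [Finset.prod_mul_distrib, Finset.prod_const, Finset.card_univ, Fintype.card_fin]

lemma exp_l1norm_le {d : ℕ} {c : ℝ} (y : Fin d → ℝ) :
    Real.exp (c * l1norm y) ≤ ∑ e, Real.exp (signVec c e ⬝ᵥ y) := by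
  let e : Fin d → Bool := fun i => decide (0 ≤ y i)
  have he : c * l1norm y = signVec c e ⬝ᵥ y := by
    rw [l1norm, Finset.mul_sum, dotProduct]
    refine Finset.sum_congr rfl fun i _ => ?_
    by_cases h : 0 ≤ y i
    · simp [signVec, e, h, abs_of_nonneg h]
    · simp [signVec, e, h, abs_of_neg (not_le.mp h)]
  rw [he]
  exact Finset.single_le_sum (f := fun e => Real.exp (signVec c e ⬝ᵥ y))
    (fun _ _ => (Real.exp_pos _).le) (Finset.mem_univ e)

namespace Inputs

variable {d m : ℕ} {Ω : Type u} {I : Inputs m Ω} {S : Model d m} {G : Grid}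

/-- Minimality of the infimum. If no arrival exceeds T, the infimum of the empty set is 0 and τ_0 =
0, so divergence of τ_k is never needed. -/
lemma tau_count_le {T : ℝ} (hT : 0 ≤ T) (ω : Ω) : I.tau (I.count T ω) ω ≤ T := by
  rcases Nat.eq_zero_or_pos (I.count T ω) with h | h
  · rw [h]; simpa [tau] using hT
  · by_contra hlt
    have h1 : I.count T ω - 1 ∈ {n : ℕ | T < I.tau (n + 1) ω} := by
      simp only [Set.mem_ofPred_eq]
      rw [Nat.sub_add_cancel h]
      exact not_le.mp hlt
    have h2 : I.count T ω ≤ I.count T ω - 1 := Nat.sInf_le h1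
    omega

lemma gridIncrement_eq {ω : Ω} (hcont : ∀ o, Continuous fun t => I.brownian o t ω) (T : ℝ) (n : ℕ)
    (k : ℕ) (o : Option (Fin m)) : gridIncrement T n (fun k => I.xi k ω) (I.noise ω) k o
      = I.brownian o (stoppedGrid T n (fun k => I.xi k ω) (k + 1)).toNNReal ω
        - I.brownian o (stoppedGrid T n (fun k => I.xi k ω) k).toNNReal ω := by
  have hc : Continuous (noisePath (I.noise ω) o) := hcont o
  rw [gridIncrement, evalLim_eq hc, evalLim_eq hc]
  rfl

lemma stoppedGrid_eq_tau {T : ℝ} {n k : ℕ} (hk : k ≤ n) (ω : Ω) :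
    stoppedGrid T n (fun k => I.xi k ω) k = I.tau k ω := by
  rw [stoppedGrid, if_pos hk]; rfl

lemma eulerGrid_eq_chain {ω : Ω} (hcont : ∀ o, Continuous fun t => I.brownian o t ω) (T : ℝ)
    (x : Fin d → ℝ) {n k : ℕ} (hk : k ≤ n) :
    I.eulerGrid S x k ω = S.chain x (stoppedGrid T n fun k => I.xi k ω)
      (gridIncrement T n (fun k => I.xi k ω) (I.noise ω)) k := by
  induction k with
  | zero => rfl
  | succ k ih =>
    rw [eulerGrid, move, ih (by omega), Model.chain, gridIncrement_eq hcont,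
      stoppedGrid_eq_tau hk, stoppedGrid_eq_tau (by omega)]
    congr 1
    funext i
    rw [gridIncrement_eq hcont, stoppedGrid_eq_tau hk, stoppedGrid_eq_tau (by omega)]
    rfl

lemma euler_eq_chain {ω : Ω} (hcont : ∀ o, Continuous fun t => I.brownian o t ω) (T : ℝ)
    (x : Fin d → ℝ) :
    I.euler S x T ω = S.chain x (stoppedGrid T (I.count T ω) fun k => I.xi k ω)
      (gridIncrement T (I.count T ω) (fun k => I.xi k ω) (I.noise ω)) (I.count T ω + 1) := by
  rw [euler, move, eulerGrid_eq_chain hcont T x le_rfl, Model.chain, gridIncrement_eq hcont,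
    stoppedGrid_last, stoppedGrid_eq_tau le_rfl]
  congr 1
  funext i
  rw [gridIncrement_eq hcont, stoppedGrid_last, stoppedGrid_eq_tau le_rfl]
  rfl

/-- The bound for the factor contributed by an arrival after a waiting time `t`. -/
def jumpFactor (G : Grid) (C p t : ℝ) : ℝ := C * t ^ (-p / 2) / G.psi t ^ p

lemma measurable_jumpFactor (C p : ℝ) : Measurable (jumpFactor G C p) :=
  ((measurable_id.pow_const _).const_mul _).div (Grid.measurable_psi.pow_const _)

/-- Of N_T only τ_N ≤ T is used, not τ_{N+1} > T. The prefactor of Θ₂ is bounded by a constant, each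
θ/ψ by `jumpFactor` times an exponential that `chainWeight` absorbs, and the ℓ¹ norm by the sum over
signs. -/
lemma integrand_le (hG : G.IsValid) {C p : ℝ} (hp : 0 < p)
    (hθ : ∀ t, 0 < t → t ≤ G.T → ∀ (z : (Fin d → ℝ) × ℝ) (w : Fin m → ℝ) (wb : ℝ),
      |S.theta t z (S.eulerStep z t w wb)| ^ p
        ≤ C * t ^ (-p / 2) * Real.exp (Model.scaledSize t w wb)) (c₁ c₂ : ℝ) (x : Fin d → ℝ)
    {ω : Ω} (hpos : ∀ k, 0 < I.xi k ω) (hcont : ∀ o, Continuous fun t => I.brownian o t ω) :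
    ENNReal.ofReal (|Real.exp (-(I.euler S x G.T ω).2)
      * Real.exp (c₁ * l1norm (I.euler S x G.T ω).1 + c₂) * I.Theta2 S G x ω| ^ p)
      ≤ ∑ e : Fin d → Bool, ENNReal.ofReal (Real.exp (p * c₂) * (1 / G.survival G.T) ^ p)
        * S.gridWeight (jumpFactor G C p) G.T (signVec (p * c₁) e) p x (I.count G.T ω)
          (fun k => I.xi k ω) (I.noise ω) := by
  set n := I.count G.T ω with hn
  set u : ℕ → ℝ := fun k => I.xi k ω with hu
  set s := stoppedGrid G.T n u with hs
  set D := gridIncrement G.T n u (I.noise ω) with hD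
  have hτ : I.tau n ω ≤ G.T := tau_count_le hG.T_pos.le ω
  have hmem : u ∈ arrivalsBefore G.T n := ⟨fun k _ => hpos k, hτ⟩
  have hgap : ∀ k, k < n → s (k + 1) - s k = u k := fun k hk => by
    rw [hs, stoppedGrid, stoppedGrid, if_pos (Nat.succ_le_of_lt hk), if_pos hk.le, arrival, arrival,
      Finset.sum_range_succ, add_sub_cancel_left]
  have huT : ∀ k, k < n → u k ≤ G.T := fun k hk => by
    rw [← hgap k hk]
    have h1 := monotone_stoppedGrid hmem (show k + 1 ≤ n + 1 by omega)
    rw [stoppedGrid_last] at h1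
    linarith [stoppedGrid_nonneg hmem k]
  have hjump : ∀ k, k < n → 0 ≤ jumpFactor G C p (u k) := fun k hk => by
    have h1 := hθ (u k) (hpos k) (huT k hk) 0 0 0
    -- The sign is read off the bound for θ at one particular state, since C carries no sign
    -- hypothesis.
    have h2 : 0 ≤ C * u k ^ (-p / 2) := by
      by_contra hneg
      have : 0 ≤ |S.theta (u k) 0 (S.eulerStep 0 (u k) 0 0)| ^ p := by positivity
      have := mul_neg_of_neg_of_pos (not_le.mp hneg)
        (Real.exp_pos (Model.scaledSize (u k) (0 : Fin m → ℝ) 0))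
      linarith
    exact div_nonneg h2 (Real.rpow_nonneg (hG.psi_nonneg _) _)
  have heuler : I.euler S x G.T ω = S.chain x s D (n + 1) := euler_eq_chain hcont G.T x
  set Y := (S.chain x s D (n + 1)).1 with hY
  set A := (S.chain x s D (n + 1)).2 with hA
  have hprod : ∏ k ∈ Finset.range n, |S.theta (I.tau (k + 1) ω - I.tau k ω) (I.eulerGrid S x k ω)
        (I.eulerGrid S x (k + 1) ω) / G.psi (I.tau (k + 1) ω - I.tau k ω)| ^ p
      ≤ (∏ k ∈ Finset.range n, jumpFactor G C p (u k)) * Real.exp (∑ j ∈ Finset.range (n + 1),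
        Model.scaledSize (s (j + 1) - s j) (fun i => D j (some i)) (D j none)) := by
    calc _ ≤ ∏ k ∈ Finset.range n, jumpFactor G C p (u k)
          * Real.exp (Model.scaledSize (s (k + 1) - s k) (fun i => D k (some i)) (D k none)) := by
          refine Finset.prod_le_prod (fun _ _ => by positivity) fun k hk => ?_
          have hk' := Finset.mem_range.mp hk
          have e1 : I.tau (k + 1) ω - I.tau k ω = s (k + 1) - s k := by
            rw [hs, hu, stoppedGrid_eq_tau hk', stoppedGrid_eq_tau hk'.le]
          rw [e1, eulerGrid_eq_chain hcont G.T x hk'.le, eulerGrid_eq_chain hcont G.T x hk', ← hu,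
            ← hs, ← hD, Model.chain, hgap k hk', abs_div,
              Real.div_rpow (abs_nonneg _) (abs_nonneg _),
            abs_of_nonneg (hG.psi_nonneg _), jumpFactor, div_mul_eq_mul_div]
          exact div_le_div_of_nonneg_right (hθ _ (hpos k) (huT k hk') _ _ _)
            (Real.rpow_nonneg (hG.psi_nonneg _) _)
      _ = (∏ k ∈ Finset.range n, jumpFactor G C p (u k)) * Real.exp (∑ j ∈ Finset.range n,
            Model.scaledSize (s (j + 1) - s j) (fun i => D j (some i)) (D j none)) := by
          rw [Finset.prod_mul_distrib, Real.exp_sum]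
      -- There are n factors θ but n + 1 steps in `chainWeight`; the nonnegative scaled size of the
      -- step from τ_n to T is added.
      _ ≤ _ := by
          refine mul_le_mul_of_nonneg_left (Real.exp_le_exp.mpr ?_)
            (Finset.prod_nonneg fun k hk => hjump k (Finset.mem_range.mp hk))
          rw [Finset.sum_range_succ _ n]
          linarith [Model.scaledSize_nonneg (s (n + 1) - s n) (fun i => D n (some i)) (D n none)]
  have hΨ : (1 / G.survival (G.T - I.tau n ω)) ^ p ≤ (1 / G.survival G.T) ^ p := by
    have h0 := hG.survival_pos
    have h1 : G.survival G.T ≤ G.survival (G.T - I.tau n ω) := by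
      refine hG.survival_anti ?_
      have : 0 ≤ I.tau n ω := by
        rw [← stoppedGrid_eq_tau (T := G.T) le_rfl ω]; exact stoppedGrid_nonneg hmem n
      linarith
    have := h0.trans_le h1
    gcongr
  have hΨ0 : 0 ≤ 1 / G.survival (G.T - I.tau n ω) := by
    refine one_div_nonneg.mpr ?_
    exact setIntegral_nonneg measurableSet_Ioi fun t _ => hG.psi_nonneg t
  have key : |Real.exp (-A) * Real.exp (c₁ * l1norm Y + c₂) * I.Theta2 S G x ω| ^ p
      ≤ ∑ e : Fin d → Bool, Real.exp (p * c₂) * (1 / G.survival G.T) ^ p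
        * ((∏ k ∈ Finset.range n, jumpFactor G C p (u k))
          * S.chainWeight (signVec (p * c₁) e) p x s D (n + 1)) := by
    have hΘ : |I.Theta2 S G x ω| ^ p ≤ (1 / G.survival G.T) ^ p
        * ((∏ k ∈ Finset.range n, jumpFactor G C p (u k)) * Real.exp (∑ j ∈ Finset.range (n + 1),
          Model.scaledSize (s (j + 1) - s j) (fun i => D j (some i)) (D j none))) := by
      rw [Theta2, ← hn, abs_mul, Real.mul_rpow (abs_nonneg _) (abs_nonneg _), abs_of_nonneg hΨ0,
        Finset.abs_prod, ← Real.finsetProd_rpow _ _ fun _ _ => abs_nonneg _]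
      refine mul_le_mul hΨ hprod (Finset.prod_nonneg fun _ _ => by positivity) ?_
      exact Real.rpow_nonneg (one_div_nonneg.mpr hG.survival_pos.le) _
    have hexp : |Real.exp (-A) * Real.exp (c₁ * l1norm Y + c₂)| ^ p
        ≤ Real.exp (-(p * A)) * Real.exp (p * c₂) * ∑ e, Real.exp (signVec (p * c₁) e ⬝ᵥ Y) := by
      rw [abs_of_pos (by positivity), ← Real.exp_add, ← Real.exp_mul]
      calc _ = Real.exp (-(p * A)) * Real.exp (p * c₂) * Real.exp (p * c₁ * l1norm Y) := by
            rw [← Real.exp_add, ← Real.exp_add]; congr 1; ring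
        _ ≤ _ := by gcongr; exact exp_l1norm_le Y
    rw [abs_mul, Real.mul_rpow (abs_nonneg _) (abs_nonneg _)]
    refine (mul_le_mul hexp hΘ (by positivity) (by positivity)).trans (le_of_eq ?_)
    rw [Finset.mul_sum, Finset.sum_mul]
    refine Finset.sum_congr rfl fun e _ => ?_
    rw [Model.chainWeight, Real.exp_add, sub_eq_add_neg, Real.exp_add]
    ring
  rw [heuler]
  refine (ENNReal.ofReal_le_ofReal key).trans (le_of_eq ?_)
  have hJ : 0 ≤ ∏ k ∈ Finset.range n, jumpFactor G C p (u k) :=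
    Finset.prod_nonneg fun k hk => hjump k (Finset.mem_range.mp hk)
  have hΨT : 0 ≤ (1 / G.survival G.T) ^ p :=
    Real.rpow_nonneg (one_div_nonneg.mpr hG.survival_pos.le) _
  have hW : ∀ e, 0 ≤ S.chainWeight (signVec (p * c₁) e) p x s D (n + 1) := fun e =>
    (Real.exp_pos _).le
  rw [ENNReal.ofReal_sum_of_nonneg fun e _ =>
    mul_nonneg (mul_nonneg (Real.exp_pos _).le hΨT) (mul_nonneg hJ (hW e))]
  refine Finset.sum_congr rfl fun e _ => ?_
  rw [ENNReal.ofReal_mul (mul_nonneg (Real.exp_pos _).le hΨT), ENNReal.ofReal_mul hJ,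
    Model.gridWeight, Set.indicator_of_mem hmem,
    ENNReal.ofReal_prod_of_nonneg fun k hk => hjump k (Finset.mem_range.mp hk)]

end Inputs

/-- Reduction of the moment to expectations over the interarrival times. -/
lemma moment_le_tsum {d m : ℕ} {S : Model d m} {a₁ a₂ lam₁ lam₂ : ℝ}
    (hS : S.IsAdmissible a₁ a₂ lam₁ lam₂) {G : Grid} (hG : G.IsValid) {C p Kmu : ℝ} (hp : 0 < p)
    (hθ : ∀ t, 0 < t → t ≤ G.T → ∀ (z : (Fin d → ℝ) × ℝ) (w : Fin m → ℝ) (wb : ℝ),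
      |S.theta t z (S.eulerStep z t w wb)| ^ p
        ≤ C * t ^ (-p / 2) * Real.exp (Model.scaledSize t w wb))
    (hmu : ∀ y, ‖S.mu y‖ ≤ Kmu) {c₁ : ℝ} (hc₁ : 0 < c₁) (c₂ : ℝ) (x : Fin d → ℝ)
    {Ω : Type u} [MeasurableSpace Ω] {P : Measure Ω} [IsProbabilityMeasure P] {I : Inputs m Ω}
    (hI : I.HasStandardLaw G P) :
    moment P I S G x (fun y => Real.exp (c₁ * l1norm y + c₂)) p
      ≤ ENNReal.ofReal (Real.exp (p * c₂) * (1 / G.survival G.T) ^ p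
          * (2 ^ d * ∏ i, Real.cosh (c₁ * p * x i))
          * Real.exp ((Kmu * (d * (p * c₁)) + p ^ 2 * S.sigmaA ^ 2
            + a₂ * (d * (p * c₁) ^ 2)) * G.T))
        * ∑' n, ENNReal.ofReal (((2 * Real.exp 1) ^ (m + 1)) ^ (n + 1))
          * ∫⁻ ω, (arrivalsBefore G.T n).indicator (fun u => ∏ k ∈ Finset.range n,
            ENNReal.ofReal (Inputs.jumpFactor G C p (u k))) (fun k => I.xi k ω) ∂P := by
  set c : ℝ := Real.exp (p * c₂) * (1 / G.survival G.T) ^ p with hc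
  have hc0 : 0 ≤ c := mul_nonneg (Real.exp_pos _).le
    (Real.rpow_nonneg (one_div_nonneg.mpr hG.survival_pos.le) _)
  set κ : ℝ := Kmu * (d * (p * c₁)) + p ^ 2 * S.sigmaA ^ 2 + a₂ * (d * (p * c₁) ^ 2) with hκ
  have hrate : ∀ e : Fin d → Bool, S.stepRate a₂ Kmu (signVec (p * c₁) e) p = κ := fun e => by
    have h1 : ∀ i, |signVec (p * c₁) e i| = p * c₁ := fun i => by
      have : 0 < p * c₁ := mul_pos hp hc₁
      unfold signVec; split_ifs <;> simp [abs_of_pos this]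
    have h2 : ∀ i, signVec (p * c₁) e i ^ 2 = (p * c₁) ^ 2 := fun i => by
      rw [← sq_abs, h1]
    simp [Model.stepRate, h1, h2, hκ]
  have hξ : Measurable fun ω => ((fun k => I.xi k ω : ℕ → ℝ), I.noise ω) :=
    (measurable_pi_lambda _ hI.xi_meas).prodMk hI.measurable_noise
  have hmeas : ∀ (e : Fin d → Bool) n, Measurable fun ω =>
      S.gridWeight (Inputs.jumpFactor G C p) G.T (signVec (p * c₁) e) p x n
        (fun k => I.xi k ω) (I.noise ω) := fun e n =>
    (hS.measurable_gridWeight (Inputs.measurable_jumpFactor C p) G.T (signVec (p * c₁) e) p x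
      n).comp hξ
  have hbound : ∀ (e : Fin d → Bool) n, ∫⁻ ω, S.gridWeight (Inputs.jumpFactor G C p) G.T
      (signVec (p * c₁) e) p x n (fun k => I.xi k ω) (I.noise ω) ∂P
      ≤ ENNReal.ofReal (Real.exp (signVec (p * c₁) e ⬝ᵥ x))
        * (ENNReal.ofReal (Real.exp (κ * G.T))
        * (ENNReal.ofReal (((2 * Real.exp 1) ^ (m + 1)) ^ (n + 1))
        * ∫⁻ ω, (arrivalsBefore G.T n).indicator (fun u => ∏ k ∈ Finset.range n,
            ENNReal.ofReal (Inputs.jumpFactor G C p (u k))) (fun k => I.xi k ω) ∂P)) := by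
    intro e n
    have h := hS.lintegral_gridWeight_le hmu (Inputs.measurable_jumpFactor (G := G) C p) G.T
      (signVec (p * c₁) e) hp.le x hI n
    rw [hrate e, ENNReal.ofReal_mul (by positivity), ENNReal.ofReal_mul (by positivity)] at h
    refine h.trans (le_of_eq ?_)
    ring
  rw [moment]
  calc _ ≤ ∫⁻ ω, ∑' n, ∑ e : Fin d → Bool, ENNReal.ofReal c
        * S.gridWeight (Inputs.jumpFactor G C p) G.T (signVec (p * c₁) e) p x n
          (fun k => I.xi k ω) (I.noise ω) ∂P := by
        refine lintegral_mono_ae ?_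
        filter_upwards [hI.ae_xi_pos, hI.ae_continuous] with ω h1 h2
        refine (Inputs.integrand_le hG hp hθ c₁ c₂ x h1 h2).trans ?_
        -- The random index disappears: its term is one of those in the sum over all n.
        exact ENNReal.le_tsum (f := fun n => ∑ e : Fin d → Bool, ENNReal.ofReal c
          * S.gridWeight (Inputs.jumpFactor G C p) G.T (signVec (p * c₁) e) p x n
          (fun k => I.xi k ω) (I.noise ω)) (I.count G.T ω)
    _ = ∑' n, ∑ e : Fin d → Bool, ENNReal.ofReal c
        * ∫⁻ ω, S.gridWeight (Inputs.jumpFactor G C p) G.T (signVec (p * c₁) e) p x n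
          (fun k => I.xi k ω) (I.noise ω) ∂P := by
        rw [lintegral_tsum fun n =>
          (Finset.measurable_sum _ fun e _ => (hmeas e n).const_mul _).aemeasurable]
        refine tsum_congr fun n => ?_
        rw [lintegral_finsetSum _ fun e _ => (hmeas e n).const_mul _]
        exact Finset.sum_congr rfl fun e _ => lintegral_const_mul _ (hmeas e n)
    _ ≤ ∑' n, ∑ e : Fin d → Bool, ENNReal.ofReal c
        * (ENNReal.ofReal (Real.exp (signVec (p * c₁) e ⬝ᵥ x))
        * (ENNReal.ofReal (Real.exp (κ * G.T))
        * (ENNReal.ofReal (((2 * Real.exp 1) ^ (m + 1)) ^ (n + 1))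
        * ∫⁻ ω, (arrivalsBefore G.T n).indicator (fun u => ∏ k ∈ Finset.range n,
            ENNReal.ofReal (Inputs.jumpFactor G C p (u k))) (fun k => I.xi k ω) ∂P))) := by
        gcongr with n e
        exact hbound e _
    _ = _ := by
        rw [← ENNReal.tsum_mul_left]
        refine tsum_congr fun n => ?_
        have hcosh : 0 ≤ c * (2 ^ d * ∏ i, Real.cosh (p * c₁ * x i)) :=
          mul_nonneg hc0 (mul_nonneg (by positivity)
            (Finset.prod_nonneg fun i _ => (Real.cosh_pos _).le))
        rw [← Finset.mul_sum, ← Finset.sum_mul, ← ENNReal.ofReal_sum_of_nonneg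
          fun _ _ => (Real.exp_pos _).le, sum_exp_signVec, mul_comm c₁ p,
          ENNReal.ofReal_mul hcosh, ENNReal.ofReal_mul hc0]
        ring

/-! ### Estimates over the grid -/

/-- The exponentially damped power `t ^ (α - 1) * exp (-L t)` on `(0, ∞)`. -/
def dampedPow (α L : ℝ) : ℝ → ℝ≥0∞ :=
  (Set.Ioi 0).indicator fun t => ENNReal.ofReal (t ^ (α - 1) * Real.exp (-(L * t)))

lemma measurable_dampedPow (α L : ℝ) : Measurable (dampedPow α L) := by
  refine Measurable.indicator ?_ measurableSet_Ioi
  exact ((measurable_id.pow_const _).mul (measurable_id.const_mul L).neg.exp).ennreal_ofReal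

lemma lintegral_dampedPow {α L : ℝ} (hα : 0 < α) (hL : 0 < L) :
    ∫⁻ t, dampedPow α L t = ENNReal.ofReal ((1 / L) ^ α * Real.Gamma α) := by
  have hint : IntegrableOn (fun t : ℝ => t ^ (α - 1) * Real.exp (-(L * t))) (Set.Ioi 0) := by
    have := integrableOn_rpow_mul_exp_neg_mul_rpow (p := 1) (s := α - 1) (b := L) (by linarith)
      one_pos hL
    simpa using this
  rw [dampedPow, lintegral_indicator measurableSet_Ioi,
    ← Real.integral_rpow_mul_exp_neg_mul_Ioi hα hL,
    ofReal_integral_eq_lintegral_ofReal hint]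
  filter_upwards [ae_restrict_mem measurableSet_Ioi] with t ht
  exact mul_nonneg (Real.rpow_nonneg (le_of_lt ht) _) (Real.exp_pos _).le

/-- The integral equals Γ(α) L^(-α) and tends to 0 as L grows, so strong damping beats any constant
q per step. The value 1/2 is the ratio of the later geometric series. -/
lemma exists_mul_lintegral_dampedPow_le {α q : ℝ} (hα : 0 < α) :
    ∃ L : ℝ, 0 < L ∧ ENNReal.ofReal q * ∫⁻ t, dampedPow α L t ≤ 1 / 2 := by
  have h1 : Filter.Tendsto (fun L : ℝ => q * ((1 / L) ^ α * Real.Gamma α)) Filter.atTop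
      (nhds (q * (0 * Real.Gamma α))) := by
    refine (Filter.Tendsto.mul_const _ ?_).const_mul _
    refine (tendsto_rpow_neg_atTop hα).congr' ?_
    filter_upwards [Filter.eventually_gt_atTop 0] with L hL
    rw [one_div, Real.inv_rpow hL.le, Real.rpow_neg hL.le]
  rw [zero_mul, mul_zero] at h1
  obtain ⟨L, hL1, hL0⟩ := ((h1.eventually (gt_mem_nhds (by norm_num : (0 : ℝ) < 1 / 2))).and
    (Filter.eventually_gt_atTop 0)).exists
  refine ⟨L, hL0, ?_⟩
  have hnn : 0 ≤ (1 / L) ^ α * Real.Gamma α := by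
    have := (Real.Gamma_pos_of_pos hα).le
    positivity
  rw [lintegral_dampedPow hα hL0, ← ENNReal.ofReal_mul' hnn]
  refine (ENNReal.ofReal_le_ofReal hL1.le).trans (le_of_eq ?_)
  rw [ENNReal.ofReal_div_of_pos two_pos]; simp

namespace Grid

variable {G : Grid}

/-- The integrability exponent: the integrand of `gridSum` behaves like `gap ^ (α - 1)`. -/
def gapExponent (G : Grid) (p : ℝ) : ℝ := 1 - G.γ - p * (1 / 2 - G.γ)

/-- The constant of the density `psi`. -/
def psiConst (G : Grid) : ℝ := (1 - G.γ) / (G.T + G.ε) ^ (1 - G.γ)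

lemma IsValid.psiConst_pos (hG : G.IsValid) : 0 < G.psiConst := hG.psi_const_pos

/-- The powers of t add up to -p/2 - γ(1 - p) = α - 1, so α > 0 is exactly integrability at 0. -/
lemma IsValid.jumpFactor_mul_psi (hG : G.IsValid) (C p : ℝ) {t : ℝ}
    (ht : t ∈ Set.Ioc 0 (G.T + G.ε)) :
    G.psi t * Inputs.jumpFactor G C p t
      = C * G.psiConst ^ (1 - p) * t ^ (G.gapExponent p - 1) := by
  have hc := hG.psiConst_pos
  have hψ : G.psi t = G.psiConst * t ^ (-G.γ) := psi_eq_of_mem ht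
  have hψ0 : 0 < G.psi t := by rw [hψ]; exact mul_pos hc (Real.rpow_pos_of_pos ht.1 _)
  have h1 : G.psi t * Inputs.jumpFactor G C p t = C * t ^ (-p / 2) * G.psi t ^ (1 - p) := by
    rw [Inputs.jumpFactor, Real.rpow_sub hψ0, Real.rpow_one]; ring
  rw [h1, hψ, Real.mul_rpow hc.le (Real.rpow_nonneg ht.1.le _), ← Real.rpow_mul ht.1.le]
  have h2 : t ^ (G.gapExponent p - 1) = t ^ (-p / 2) * t ^ (-G.γ * (1 - p)) := by
    rw [← Real.rpow_add ht.1]; congr 1; rw [gapExponent]; ring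
  rw [h2]; ring

lemma IsValid.lintegral_jumpFactor_le (hG : G.IsValid) {C : ℝ} (hC : 0 ≤ C) (p L : ℝ) :
    ∫⁻ t, ENNReal.ofReal (Inputs.jumpFactor G C p t * Real.exp (-(L * t))) ∂G.arrivalLaw
      ≤ ENNReal.ofReal (C * G.psiConst ^ (1 - p)) * ∫⁻ t, dampedPow (G.gapExponent p) L t := by
  have hm : Measurable fun t => ENNReal.ofReal (Inputs.jumpFactor G C p t * Real.exp (-(L * t))) :=
    ((Inputs.measurable_jumpFactor C p).mul (measurable_id.const_mul L).neg.exp).ennreal_ofReal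
  rw [arrivalLaw, lintegral_withDensity_eq_lintegral_mul _ measurable_psi.ennreal_ofReal hm,
    ← lintegral_const_mul _ (measurable_dampedPow _ _)]
  refine lintegral_mono fun t => ?_
  rw [Pi.mul_apply, ← ENNReal.ofReal_mul (hG.psi_nonneg t)]
  by_cases ht : t ∈ Set.Ioc 0 (G.T + G.ε)
  · rw [dampedPow, Set.indicator_of_mem (show t ∈ Set.Ioi (0 : ℝ) from ht.1),
      ← ENNReal.ofReal_mul (mul_nonneg hC (Real.rpow_nonneg hG.psiConst_pos.le _)), ← mul_assoc,
      hG.jumpFactor_mul_psi C p ht, mul_assoc]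
  · have : G.psi t = 0 := by rw [psi_eq_indicator, Set.indicator_of_notMem ht]
    simp [this]

/-- On `arrivalsBefore` the waiting times sum to at most T, hence 1 ≤ e^(LT) ∏ e^(-L u_k). With this
factor in place the constraint is dropped and the independent factors are integrated one by one. -/
lemma IsValid.lintegral_arrivals_le (hG : G.IsValid) {C : ℝ} (hC : 0 ≤ C) (p : ℝ) {L : ℝ}
    (hL : 0 < L) {m : ℕ} {Ω : Type u} [MeasurableSpace Ω] {P : Measure Ω} {I : Inputs m Ω}
    (hI : I.HasStandardLaw G P) (n : ℕ) :
    ∫⁻ ω, (arrivalsBefore G.T n).indicator (fun u => ∏ k ∈ Finset.range n,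
        ENNReal.ofReal (Inputs.jumpFactor G C p (u k))) (fun k => I.xi k ω) ∂P
      ≤ ENNReal.ofReal (Real.exp (L * G.T)) * (ENNReal.ofReal (C * G.psiConst ^ (1 - p))
        * ∫⁻ t, dampedPow (G.gapExponent p) L t) ^ n := by
  have hm : Measurable fun t => ENNReal.ofReal (Inputs.jumpFactor G C p t * Real.exp (-(L * t))) :=
    ((Inputs.measurable_jumpFactor C p).mul (measurable_id.const_mul L).neg.exp).ennreal_ofReal
  have hmξ : ∀ k, Measurable fun ω => ENNReal.ofReal
      (Inputs.jumpFactor G C p (I.xi k ω) * Real.exp (-(L * I.xi k ω))) :=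
    fun k => hm.comp (hI.xi_meas k)
  calc _ ≤ ∫⁻ ω, ENNReal.ofReal (Real.exp (L * G.T)) * ∏ k ∈ Finset.range n,
        ENNReal.ofReal (Inputs.jumpFactor G C p (I.xi k ω) * Real.exp (-(L * I.xi k ω))) ∂P := by
        refine lintegral_mono fun ω => ?_
        refine Set.indicator_le' (f := fun u : ℕ → ℝ => ∏ k ∈ Finset.range n,
          ENNReal.ofReal (Inputs.jumpFactor G C p (u k)))
          (g := fun u => ENNReal.ofReal (Real.exp (L * G.T)) * ∏ k ∈ Finset.range n,
          ENNReal.ofReal (Inputs.jumpFactor G C p (u k) * Real.exp (-(L * u k))))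
          (fun u hu => ?_) (fun _ _ => zero_le) _
        have h1 : ∀ k, ENNReal.ofReal (Inputs.jumpFactor G C p (u k) * Real.exp (-(L * u k)))
            = ENNReal.ofReal (Inputs.jumpFactor G C p (u k))
              * ENNReal.ofReal (Real.exp (-(L * u k))) := fun k =>
          ENNReal.ofReal_mul' (Real.exp_pos _).le
        simp only [h1]
        rw [Finset.prod_mul_distrib, ← ENNReal.ofReal_prod_of_nonneg
          (f := fun k => Real.exp (-(L * u k))) fun _ _ => (Real.exp_pos _).le, ← Real.exp_sum,
          mul_left_comm, ← ENNReal.ofReal_mul (Real.exp_pos _).le, ← Real.exp_add]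
        refine le_mul_of_one_le_right zero_le ?_
        rw [← ENNReal.ofReal_one]
        refine ENNReal.ofReal_le_ofReal (Real.one_le_exp ?_)
        rw [Finset.sum_neg_distrib, ← Finset.mul_sum]
        have : ∑ k ∈ Finset.range n, u k ≤ G.T := hu.2
        nlinarith
    _ = ENNReal.ofReal (Real.exp (L * G.T)) * ∏ k ∈ Finset.range n,
        ∫⁻ t, ENNReal.ofReal (Inputs.jumpFactor G C p t * Real.exp (-(L * t))) ∂G.arrivalLaw := by
        rw [lintegral_const_mul _ (Finset.measurable_prod _ fun k _ => hmξ k)]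
        rw [lintegral_prod_eq_prod_lintegral_of_indepFun (Finset.range n) (fun k ω => ENNReal.ofReal
          (Inputs.jumpFactor G C p (I.xi k ω) * Real.exp (-(L * I.xi k ω))))
          (hI.xi_indep.comp _ fun _ => hm) hmξ]
        congr 1
        refine Finset.prod_congr rfl fun k _ => ?_
        rw [← hI.xi_law k, lintegral_map hm (hI.xi_meas k)]
    _ ≤ _ := by
        rw [Finset.prod_const, Finset.card_range]
        gcongr
        exact hG.lintegral_jumpFactor_le hC p L

/-! #### The deterministic grid sum -/

lemma gap_snoc_castSucc {n : ℕ} (s : Fin n → ℝ) (a : ℝ) (j : Fin n) :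
    gap (Fin.snoc (α := fun _ => ℝ) s a) j.castSucc = gap s j := by
  have h : pts (Fin.snoc (α := fun _ => ℝ) s a) = Fin.snoc (α := fun _ => ℝ) (pts s) a :=
    Fin.cons_snoc_eq_snoc_cons _ _ _
  rw [gap, gap, h, ← Fin.castSucc_succ, Fin.snoc_castSucc, Fin.snoc_castSucc]

lemma gap_snoc_last {n : ℕ} (s : Fin n → ℝ) (a : ℝ) :
    gap (Fin.snoc (α := fun _ => ℝ) s a) (Fin.last n) = a - pts s (Fin.last n) := by
  have h : pts (Fin.snoc (α := fun _ => ℝ) s a) = Fin.snoc (α := fun _ => ℝ) (pts s) a :=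
    Fin.cons_snoc_eq_snoc_cons _ _ _
  rw [gap, h, Fin.succ_last, Fin.snoc_last, Fin.snoc_castSucc]

lemma measurable_pts {n : ℕ} (j : Fin (n + 1)) : Measurable fun s : Fin n → ℝ => pts s j := by
  refine Fin.cases ?_ (fun i => ?_) j
  · simp only [pts, Fin.cons_zero]; exact measurable_const
  · simp only [pts, Fin.cons_succ]; exact measurable_pi_apply i

lemma measurable_gap {n : ℕ} (j : Fin n) : Measurable fun s : Fin n → ℝ => gap s j :=
  (measurable_pts _).sub (measurable_pts _)

lemma volume_univ_fin_zero : (volume : Measure (Fin 0 → ℝ)) Set.univ = 1 := by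
  rw [volume_pi, Measure.pi_univ, Finset.univ_eq_empty, Finset.prod_empty]

/-- The gaps are independent coordinates for the Lebesgue measure. -/
lemma lintegral_prod_gap {h : ℝ → ℝ≥0∞} (hh : Measurable h) (n : ℕ) :
    ∫⁻ s : Fin n → ℝ, ∏ j, h (gap s j) = (∫⁻ t, h t) ^ n := by
  induction n with
  | zero => simp only [Finset.univ_eq_empty, Finset.prod_empty, lintegral_const,
      volume_univ_fin_zero, one_mul, pow_zero]
  | succ n ih =>
    have hmp := (volume_preserving_piFinSuccAbove (fun _ : Fin (n + 1) => ℝ) (Fin.last n)).symm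
    have hsymm : ∀ q : ℝ × (Fin n → ℝ),
        (MeasurableEquiv.piFinSuccAbove (fun _ : Fin (n + 1) => ℝ) (Fin.last n)).symm q
          = Fin.snoc (α := fun _ => ℝ) q.2 q.1 := fun q => by
      simp [MeasurableEquiv.piFinSuccAbove]
      rfl
    have hmeas : Measurable fun q : ℝ × (Fin n → ℝ) =>
        (∏ j, h (gap q.2 j)) * h (q.1 - pts q.2 (Fin.last n)) :=
      (Finset.measurable_prod _ fun j _ => hh.comp ((measurable_gap j).comp measurable_snd)).mul
        (hh.comp (measurable_fst.sub ((measurable_pts _).comp measurable_snd)))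
    rw [← hmp.lintegral_comp_emb (MeasurableEquiv.measurableEmbedding _)]
    have hcongr : ∀ q : ℝ × (Fin n → ℝ), ∏ j, h (gap
        ((MeasurableEquiv.piFinSuccAbove (fun _ : Fin (n + 1) => ℝ) (Fin.last n)).symm q) j)
        = (∏ j, h (gap q.2 j)) * h (q.1 - pts q.2 (Fin.last n)) := fun q => by
      rw [hsymm, Fin.prod_univ_castSucc, gap_snoc_last]
      congr 1
      exact Finset.prod_congr rfl fun j _ => by rw [gap_snoc_castSucc]
    calc _ = ∫⁻ q : ℝ × (Fin n → ℝ),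
          (∏ j, h (gap q.2 j)) * h (q.1 - pts q.2 (Fin.last n)) := lintegral_congr hcongr
      _ = ∫⁻ s : Fin n → ℝ, ∫⁻ a : ℝ, (∏ j, h (gap s j)) * h (a - pts s (Fin.last n)) := by
          rw [Measure.volume_eq_prod, lintegral_prod_symm _ hmeas.aemeasurable]
      _ = ∫⁻ s : Fin n → ℝ, (∏ j, h (gap s j)) * ∫⁻ t, h t := by
          refine lintegral_congr fun s => ?_
          have hs : Measurable fun a : ℝ => h (a - pts s (Fin.last n)) :=
            hh.comp (measurable_id.sub_const _)
          rw [lintegral_const_mul _ hs, lintegral_sub_right_eq_self h]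
      _ = _ := by
          have hp : Measurable fun s : Fin n → ℝ => ∏ j, h (gap s j) :=
            Finset.measurable_prod _ fun j _ => hh.comp (measurable_gap j)
          rw [lintegral_mul_const _ hp, ih, pow_succ]

lemma gap_pos {n : ℕ} {s : Fin n → ℝ} (hs : s ∈ G.simplex n) (j : Fin n) : 0 < gap s j :=
  sub_pos.mpr (hs.1 j)

lemma sum_gap {n : ℕ} (s : Fin n → ℝ) : ∑ j, gap s j = pts s (Fin.last n) := by
  have key : ∀ (n : ℕ) (f : Fin (n + 1) → ℝ),
      ∑ j : Fin n, (f j.succ - f j.castSucc) = f (Fin.last n) - f 0 := fun n => by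
    induction n with
    | zero => intro f; simp
    | succ n ih =>
      intro f
      rw [Fin.sum_univ_castSucc]
      have := ih fun i => f i.castSucc
      simp only [Fin.castSucc_succ] at this ⊢
      rw [this, Fin.succ_last]
      simp
  have := key n (pts s)
  simpa [gap, pts] using this

/-- The probability of no arrival after the last grid point, as a function of that point. -/
def lastFactor (G : Grid) {n : ℕ} (s : Fin n → ℝ) : ℝ :=
  1 - ((G.T - pts s (Fin.last n)) / (G.T + G.ε)) ^ (1 - G.γ)

lemma IsValid.lastFactor_mem (hG : G.IsValid) {n : ℕ} {s : Fin n → ℝ} (hs : s ∈ G.simplex n) :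
    G.lastFactor s ∈ Set.Icc (1 - (G.T / (G.T + G.ε)) ^ (1 - G.γ)) 1 := by
  have h0 : 0 ≤ pts s (Fin.last n) := by
    rw [← sum_gap]; exact Finset.sum_nonneg fun j _ => (gap_pos hs j).le
  have h1 : pts s (Fin.last n) < G.T := hs.2
  have hh := hG.horizon_pos
  have hγ := hG.γ_lt_one
  have h2 : 0 ≤ (G.T - pts s (Fin.last n)) / (G.T + G.ε) := div_nonneg (by linarith) hh.le
  constructor
  · rw [lastFactor]
    gcongr
    linarith
  · rw [lastFactor]
    linarith [Real.rpow_nonneg h2 (1 - G.γ)]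

lemma IsValid.lastFactor_min_pos (hG : G.IsValid) :
    0 < 1 - (G.T / (G.T + G.ε)) ^ (1 - G.γ) := by
  have hh := hG.horizon_pos
  have : (G.T / (G.T + G.ε)) ^ (1 - G.γ) < 1 := by
    refine Real.rpow_lt_one (div_nonneg hG.T_pos.le hh.le) ?_ (by linarith [hG.γ_lt_one])
    rw [div_lt_one hh]; linarith [hG.ε_pos]
  linarith

/-- The exponent, later 1 - p, may have either sign, so the extrema can sit at either endpoint. -/
lemma rpow_bounds {φ₀ : ℝ} (h0 : 0 < φ₀) (r : ℝ) :
    ∃ b B : ℝ, 0 < b ∧ 0 < B ∧ ∀ φ ∈ Set.Icc φ₀ 1, b ≤ φ ^ r ∧ φ ^ r ≤ B := by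
  refine ⟨min 1 (φ₀ ^ r), max 1 (φ₀ ^ r), lt_min one_pos (Real.rpow_pos_of_pos h0 _),
    lt_max_of_lt_left one_pos, fun φ hφ => ?_⟩
  have hφ0 : 0 < φ := h0.trans_le hφ.1
  rcases le_total 0 r with hr | hr
  · exact ⟨min_le_of_right_le (Real.rpow_le_rpow h0.le hφ.1 hr),
      le_max_of_le_left (Real.rpow_le_one hφ0.le hφ.2 hr)⟩
  · exact ⟨min_le_of_left_le (Real.one_le_rpow_of_pos_of_le_one_of_nonpos hφ0 hφ.2 hr),
      le_max_of_le_right (Real.rpow_le_rpow_of_nonpos h0 hφ.1 hr)⟩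

/-- The same power α - 1 of each gap appears as under the arrival law; the last factor stays in a
compact subset of (0, 1]. -/
lemma IsValid.integrand_eq (hG : G.IsValid) (p : ℝ) {n : ℕ} {s : Fin n → ℝ}
    (hs : s ∈ G.simplex n) :
    1 / (G.pdens s) ^ (p - 1) * ∏ j, (gap s j) ^ (-p / 2)
      = G.lastFactor s ^ (1 - p) * (G.psiConst ^ (1 - p)) ^ n
        * ∏ j, gap s j ^ (G.gapExponent p - 1) := by
  have hc := hG.psiConst_pos
  have hφ : 0 < G.lastFactor s := hG.lastFactor_min_pos.trans_le (hG.lastFactor_mem hs).1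
  have hg := gap_pos hs
  have hg' : ∀ j, 0 < 1 / gap s j ^ G.γ := fun j => one_div_pos.mpr (Real.rpow_pos_of_pos (hg j) _)
  have hP : 0 < ∏ j, 1 / gap s j ^ G.γ := Finset.prod_pos fun j _ => hg' j
  have hpd : G.pdens s = G.lastFactor s * G.psiConst ^ n * ∏ j, 1 / gap s j ^ G.γ := rfl
  have hpd0 : 0 < G.pdens s := by rw [hpd]; positivity
  have h1 : 1 / (G.pdens s) ^ (p - 1) = (G.pdens s) ^ (1 - p) := by
    rw [one_div, ← Real.rpow_neg hpd0.le, neg_sub]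
  rw [h1, hpd, Real.mul_rpow (by positivity) hP.le, Real.mul_rpow hφ.le (by positivity),
    ← Real.rpow_natCast, ← Real.rpow_mul hc.le, mul_comm (n : ℝ), Real.rpow_mul hc.le,
    Real.rpow_natCast, ← Real.finsetProd_rpow _ _ fun j _ => (hg' j).le, mul_assoc,
    ← Finset.prod_mul_distrib]
  congr 1
  refine Finset.prod_congr rfl fun j _ => ?_
  rw [one_div, ← Real.rpow_neg (hg j).le, ← Real.rpow_mul (hg j).le, ← Real.rpow_add (hg j)]
  congr 1
  rw [gapExponent]; ring

lemma measurableSet_simplex (n : ℕ) : MeasurableSet (G.simplex n) := by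
  have h1 : MeasurableSet (⋂ j : Fin n, {s : Fin n → ℝ | pts s j.castSucc < pts s j.succ}) :=
    MeasurableSet.iInter fun j => measurableSet_lt (measurable_pts _) (measurable_pts _)
  convert h1.inter (measurableSet_lt (measurable_pts (Fin.last n)) (measurable_const (a := G.T)))
    using 1
  ext s; simp [simplex]

/-- The damping argument again, now for Lebesgue measure: the gaps sum to less than T, and after
damping `lintegral_prod_gap` treats them as free coordinates. -/
lemma IsValid.gridSum_lt_top (hG : G.IsValid) {p : ℝ} (hα : 0 < G.gapExponent p) :
    G.gridSum p < ⊤ := by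
  obtain ⟨b, B, hb, hB, hbB⟩ := rpow_bounds hG.lastFactor_min_pos (1 - p)
  have hc := hG.psiConst_pos
  obtain ⟨L, hL, hLq⟩ := exists_mul_lintegral_dampedPow_le (q := G.psiConst ^ (1 - p)) hα
  have hbound : ∀ n, ∫⁻ s in G.simplex n,
      ENNReal.ofReal (1 / (G.pdens s) ^ (p - 1) * ∏ j, (gap s j) ^ (-p / 2))
      ≤ ENNReal.ofReal (B * Real.exp (L * G.T)) * (1 / 2) ^ n := fun n => by
    have hmd : ∀ j : Fin n, Measurable fun s : Fin n → ℝ =>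
        dampedPow (G.gapExponent p) L (gap s j) := fun j =>
      (measurable_dampedPow _ _).comp (measurable_gap j)
    calc _ ≤ ∫⁻ s in G.simplex n, ENNReal.ofReal (B * Real.exp (L * G.T))
          * ENNReal.ofReal (G.psiConst ^ (1 - p)) ^ n
          * ∏ j, dampedPow (G.gapExponent p) L (gap s j) := by
          refine setLIntegral_mono' (measurableSet_simplex n) fun s hs => ?_
          have hg := gap_pos hs
          rw [hG.integrand_eq p hs]
          have h1 : ∀ j, dampedPow (G.gapExponent p) L (gap s j)
              = ENNReal.ofReal (gap s j ^ (G.gapExponent p - 1) * Real.exp (-(L * gap s j))) :=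
            fun j => Set.indicator_of_mem (show gap s j ∈ Set.Ioi (0 : ℝ) from hg j) _
          have h2 : ∀ j, 0 ≤ gap s j ^ (G.gapExponent p - 1) := fun j =>
            Real.rpow_nonneg (hg j).le _
          have h3 : (0 : ℝ) ≤ ∏ j, gap s j ^ (G.gapExponent p - 1) :=
            Finset.prod_nonneg fun j _ => h2 j
          simp only [h1]
          rw [← ENNReal.ofReal_prod_of_nonneg fun j _ => mul_nonneg (h2 j) (Real.exp_pos _).le,
            ← ENNReal.ofReal_pow (Real.rpow_nonneg hc.le _), ← ENNReal.ofReal_mul (by positivity),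
            ← ENNReal.ofReal_mul (by positivity), Finset.prod_mul_distrib, ← Real.exp_sum]
          refine ENNReal.ofReal_le_ofReal ?_
          rw [Finset.sum_neg_distrib, ← Finset.mul_sum, sum_gap]
          have h4 : 1 ≤ Real.exp (L * G.T) * Real.exp (-(L * pts s (Fin.last n))) := by
            rw [← Real.exp_add]
            refine Real.one_le_exp ?_
            have : pts s (Fin.last n) < G.T := hs.2
            nlinarith
          calc _ ≤ B * (G.psiConst ^ (1 - p)) ^ n * ∏ j, gap s j ^ (G.gapExponent p - 1) := by
                gcongr
                exact (hbB _ (hG.lastFactor_mem hs)).2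
            _ ≤ B * (G.psiConst ^ (1 - p)) ^ n * (∏ j, gap s j ^ (G.gapExponent p - 1))
                * (Real.exp (L * G.T) * Real.exp (-(L * pts s (Fin.last n)))) :=
                le_mul_of_one_le_right (by positivity) h4
            _ = _ := by ring
      _ ≤ ∫⁻ s, ENNReal.ofReal (B * Real.exp (L * G.T))
          * ENNReal.ofReal (G.psiConst ^ (1 - p)) ^ n
          * ∏ j, dampedPow (G.gapExponent p) L (gap s j) := setLIntegral_le_lintegral _ _
      _ = ENNReal.ofReal (B * Real.exp (L * G.T)) * (ENNReal.ofReal (G.psiConst ^ (1 - p))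
          * ∫⁻ t, dampedPow (G.gapExponent p) L t) ^ n := by
          rw [lintegral_const_mul _ (Finset.measurable_prod _ fun j _ => hmd j),
            lintegral_prod_gap (measurable_dampedPow _ _), mul_pow, mul_assoc]
      _ ≤ _ := by gcongr
  refine (ENNReal.tsum_le_tsum hbound).trans_lt ?_
  rw [ENNReal.tsum_mul_left, ENNReal.tsum_geometric]
  refine ENNReal.mul_lt_top ENNReal.ofReal_lt_top ?_
  simp

/-- The term n = 0 is an integral over a one-point space and is positive. It allows a fixed constant
to be bounded by a multiple of the grid sum. -/
lemma IsValid.exists_le_gridSum (hG : G.IsValid) (p : ℝ) :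
    ∃ g : ℝ, 0 < g ∧ ENNReal.ofReal g ≤ G.gridSum p := by
  set g : ℝ := (1 - (G.T / (G.T + G.ε)) ^ (1 - G.γ)) ^ (1 - p) with hg
  refine ⟨g, Real.rpow_pos_of_pos hG.lastFactor_min_pos _, ?_⟩
  refine le_trans (le_of_eq ?_) (ENNReal.le_tsum 0)
  have hmem : ∀ s : Fin 0 → ℝ, s ∈ G.simplex 0 := fun s =>
    ⟨fun j => j.elim0, by simpa [pts] using hG.T_pos⟩
  have h1 : ∀ s ∈ G.simplex 0,
      ENNReal.ofReal (1 / (G.pdens s) ^ (p - 1) * ∏ j, (gap s j) ^ (-p / 2))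
        = ENNReal.ofReal g := fun s hs => by
    rw [hG.integrand_eq p hs]
    simp [hg, lastFactor, pts]
  rw [setLIntegral_congr_fun (measurableSet_simplex 0) h1, setLIntegral_const,
    Set.eq_univ_of_forall hmem, volume_univ_fin_zero, mul_one]

/-- The term n = 1 already diverges, like the integral of t^(α-1) over (0, T) with α ≤ 0. -/
lemma IsValid.gridSum_eq_top (hG : G.IsValid) {p : ℝ} (hα : G.gapExponent p ≤ 0) :
    G.gridSum p = ⊤ := by
  obtain ⟨b, B, hb, hB, hbB⟩ := rpow_bounds hG.lastFactor_min_pos (1 - p)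
  have hc := hG.psiConst_pos
  rw [eq_top_iff]
  refine le_trans ?_ (ENNReal.le_tsum 1)
  have hgap : ∀ s : Fin 1 → ℝ, gap s 0 = s 0 := fun s => by simp [gap, pts]
  have hpre : (MeasurableEquiv.funUnique (Fin 1) ℝ) ⁻¹' Set.Ioo 0 G.T = G.simplex 1 := by
    ext s
    simp [simplex, pts, MeasurableEquiv.funUnique]
  have hm : Measurable fun t : ℝ =>
      ENNReal.ofReal (b * G.psiConst ^ (1 - p) * t ^ (G.gapExponent p - 1)) :=
    ((measurable_id.pow_const _).const_mul _).ennreal_ofReal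
  have key : ∫⁻ t in Set.Ioo 0 G.T,
      ENNReal.ofReal (b * G.psiConst ^ (1 - p) * t ^ (G.gapExponent p - 1)) = ⊤ := by
    by_contra hne
    have hk : 0 < b * G.psiConst ^ (1 - p) := mul_pos hb (Real.rpow_pos_of_pos hc _)
    have hint : IntegrableOn (fun t : ℝ => b * G.psiConst ^ (1 - p) * t ^ (G.gapExponent p - 1))
        (Set.Ioo 0 G.T) := by
      refine ⟨((measurable_id.pow_const _).const_mul _).aestronglyMeasurable, ?_⟩
      rw [hasFiniteIntegral_iff_ofReal]
      · exact lt_top_iff_ne_top.mpr hne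
      · filter_upwards [ae_restrict_mem measurableSet_Ioo] with t ht
        exact mul_nonneg hk.le (Real.rpow_nonneg ht.1.le _)
    have h2 : IntegrableOn (fun t : ℝ => t ^ (G.gapExponent p - 1)) (Set.Ioo 0 G.T) := by
      have := hint.const_mul (b * G.psiConst ^ (1 - p))⁻¹
      refine this.congr (Filter.Eventually.of_forall fun t => ?_)
      simp only
      rw [← mul_assoc, inv_mul_cancel₀ hk.ne', one_mul]
    have := (intervalIntegral.integrableOn_Ioo_rpow_iff hG.T_pos).mp h2
    linarith
  rw [← key, ← (volume_preserving_funUnique (Fin 1) ℝ).setLIntegral_comp_preimage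
    measurableSet_Ioo hm, hpre]
  refine setLIntegral_mono' (measurableSet_simplex 1) fun s hs => ?_
  rw [hG.integrand_eq p hs]
  refine ENNReal.ofReal_le_ofReal ?_
  have hs0 : 0 < s 0 := by rw [← hgap s]; exact gap_pos hs 0
  have h1 := (hbB _ (hG.lastFactor_mem hs)).1
  rw [pow_one, Fintype.prod_unique]
  have h2 : gap s default = MeasurableEquiv.funUnique (Fin 1) ℝ s := hgap s
  rw [h2]
  have h3 : 0 < MeasurableEquiv.funUnique (Fin 1) ℝ s := hs0
  gcongr

end Grid

/-! ### The moment bound -/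

lemma Grid.IsValid.exists_tsum_arrivals_le {G : Grid} (hG : G.IsValid) {C : ℝ} (hC : 0 ≤ C) {p : ℝ}
    (hα : 0 < G.gapExponent p) {K : ℝ} (hK : 0 < K) :
    ∃ B : ℝ, 0 < B ∧ ∀ {m : ℕ} {Ω : Type u} [MeasurableSpace Ω] {P : Measure Ω}
      [IsProbabilityMeasure P] {I : Inputs m Ω}, I.HasStandardLaw G P →
      ∑' n, ENNReal.ofReal (K ^ (n + 1))
          * ∫⁻ ω, (arrivalsBefore G.T n).indicator (fun u => ∏ k ∈ Finset.range n,
            ENNReal.ofReal (Inputs.jumpFactor G C p (u k))) (fun k => I.xi k ω) ∂P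
        ≤ ENNReal.ofReal B := by
  -- K is included in q, so the damping also beats the constant that every Euler step costs.
  obtain ⟨L, hL, hq⟩ := exists_mul_lintegral_dampedPow_le (q := K * (C * G.psiConst ^ (1 - p))) hα
  refine ⟨K * Real.exp (L * G.T) * 2, by positivity, ?_⟩
  intro m Ω _ P _ I hI
  calc _ ≤ ∑' n, ENNReal.ofReal (K * Real.exp (L * G.T)) * (1 / 2 : ℝ≥0∞) ^ n := by
        refine ENNReal.tsum_le_tsum fun n => ?_
        calc _ ≤ ENNReal.ofReal (K ^ (n + 1)) * (ENNReal.ofReal (Real.exp (L * G.T))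
              * (ENNReal.ofReal (C * G.psiConst ^ (1 - p))
                * ∫⁻ t, dampedPow (G.gapExponent p) L t) ^ n) := by
              gcongr
              exact hG.lintegral_arrivals_le hC p hL hI n
          _ = ENNReal.ofReal (K * Real.exp (L * G.T))
              * (ENNReal.ofReal (K * (C * G.psiConst ^ (1 - p)))
                * ∫⁻ t, dampedPow (G.gapExponent p) L t) ^ n := by
              rw [pow_succ, ENNReal.ofReal_mul (by positivity), ENNReal.ofReal_mul hK.le,
                ENNReal.ofReal_mul hK.le, ENNReal.ofReal_pow hK.le, mul_assoc (ENNReal.ofReal K),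
                mul_pow]
              ring
          _ ≤ _ := by gcongr
    _ = _ := by
        rw [ENNReal.tsum_mul_left, ENNReal.tsum_geometric, one_div, ENNReal.one_sub_inv_two,
          inv_inv, ENNReal.ofReal_mul (p := K * Real.exp (L * G.T)) (by positivity)]
        simp

lemma Grid.IsValid.momentConst_lt_top {d m : ℕ} (S : Model d m) {G : Grid} (hG : G.IsValid)
    (a₂ lam₂ C c₁ : ℝ) {p : ℝ} (hα : 0 < G.gapExponent p) :
    momentConst S G a₂ lam₂ C c₁ p < ⊤ :=
  ENNReal.mul_lt_top ENNReal.ofReal_lt_top (hG.gridSum_lt_top hα)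

/-- The growth rate of the moments, compared with the rate in `momentConst`. -/
lemma rate_le {a b K c p s l : ℝ} (d : ℕ) (ha : 0 < a) (hl : 0 ≤ l) (hp : 0 ≤ p)
    (hb : b = d * K ^ 2 / (4 * a)) :
    K * (d * (p * c)) + p ^ 2 * s ^ 2 + a * (d * (p * c) ^ 2)
      ≤ ((2 * c ^ 2 * a * d + s ^ 2) * p ^ 2 + l * p) + b := by
  -- Completing the square puts the drift term, linear in c, into the second copy of a(pc)² that the
  -- factor 2 provides. The remainder b does not involve c.
  have h1 : K * (p * c) ≤ a * (p * c) ^ 2 + K ^ 2 / (4 * a) := by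
    have h : a * (p * c) ^ 2 + K ^ 2 / (4 * a) - K * (p * c)
        = (2 * a * (p * c) - K) ^ 2 / (4 * a) := by field_simp; ring
    have : 0 ≤ (2 * a * (p * c) - K) ^ 2 / (4 * a) := by positivity
    linarith
  have h2 := mul_le_mul_of_nonneg_left h1 (Nat.cast_nonneg (α := ℝ) d)
  have h3 : 0 ≤ l * p := mul_nonneg hl hp
  have h4 : (d : ℝ) * (a * (p * c) ^ 2 + K ^ 2 / (4 * a)) = d * (a * (p * c) ^ 2) + b := by
    rw [hb]; ring
  rw [h4] at h2
  linarith

lemma Model.IsAdmissible.exists_moment_le {d m : ℕ} {S : Model d m} {a₁ a₂ lam₁ lam₂ : ℝ}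
    (hS : S.IsAdmissible a₁ a₂ lam₁ lam₂) {G : Grid} (hG : G.IsValid) {p : ℝ} (hp : 0 < p)
    (c₂ : ℝ) :
    ∃ C : ℝ, 0 < C ∧ ∀ c₁ : ℝ, 0 < c₁ → ∀ (x : Fin d → ℝ) (Ω : Type u) [MeasurableSpace Ω]
      (P : Measure Ω) [IsProbabilityMeasure P] (I : Inputs m Ω), I.HasStandardLaw G P →
      moment P I S G x (fun y => Real.exp (c₁ * l1norm y + c₂)) p
        ≤ momentConst S G a₂ lam₂ C c₁ p * ENNReal.ofReal (∏ i, Real.cosh (c₁ * p * x i)) := by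
  have hcosh : ∀ (c₁ : ℝ) (x : Fin d → ℝ), 0 < ∏ i, Real.cosh (c₁ * p * x i) := fun c₁ x =>
    Finset.prod_pos fun i _ => Real.cosh_pos _
  -- For a nonpositive exponent the right-hand side is infinite, because its other factors are
  -- positive, and any C serves.
  rcases le_or_gt (G.gapExponent p) 0 with hα | hα
  · refine ⟨1, one_pos, fun c₁ _ x Ω _ P _ I _ => ?_⟩
    have h1 : momentConst S G a₂ lam₂ 1 c₁ p = ⊤ := by
      rw [momentConst, hG.gridSum_eq_top hα, ENNReal.mul_top]
      exact (ENNReal.ofReal_pos.mpr (by positivity)).ne'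
    rw [h1, ENNReal.top_mul (ENNReal.ofReal_pos.mpr (hcosh c₁ x)).ne']
    exact le_top
  obtain ⟨Cθ, hCθ, hθ⟩ := hS.exists_abs_theta_rpow_le hG.T_pos hp
  obtain ⟨Kmu, -, hmu⟩ := hS.mu_reg.exists_bound
  obtain ⟨B, hB, hsum⟩ := hG.exists_tsum_arrivals_le hCθ.le hα
    (K := (2 * Real.exp 1) ^ (m + 1)) (by positivity)
  obtain ⟨g, hg, hgle⟩ := hG.exists_le_gridSum p
  have ha₂ : 0 < a₂ := hS.a₁_pos.trans_le hS.a₁_le_a₂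
  have hlam : 0 ≤ lam₂ := (hS.lam₁_pos.le.trans (hS.lam_lower 0)).trans (hS.lam_upper 0)
  have hΨ : 0 < 1 / G.survival G.T := one_div_pos.mpr hG.survival_pos
  set b : ℝ := d * Kmu ^ 2 / (4 * a₂) with hb
  set A : ℝ := Real.exp (p * c₂) * (1 / G.survival G.T) ^ p * 2 ^ d with hA
  have hA0 : 0 < A := by positivity
  -- B bounds the series over the waiting times, e^(bT) pays for the completed square, and 1/g for
  -- the passage to the grid sum. All were fixed before c₁, x and the probability space.
  refine ⟨A * Real.exp (b * G.T) * B / g, by positivity, fun c₁ hc₁ x Ω _ P _ I hI => ?_⟩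
  set R : ℝ := (2 * c₁ ^ 2 * a₂ * d + S.sigmaA ^ 2) * p ^ 2 + lam₂ * p
  set H : ℝ := ∏ i, Real.cosh (c₁ * p * x i)
  have hH : 0 < H := hcosh c₁ x
  refine (moment_le_tsum hS hG hp hθ hmu hc₁ c₂ x hI).trans ?_
  calc _ ≤ ENNReal.ofReal (A * H * (Real.exp (R * G.T) * Real.exp (b * G.T)))
        * ENNReal.ofReal B := by
        gcongr ENNReal.ofReal ?_ * ?_
        · rw [← Real.exp_add, ← add_mul, hA, mul_assoc (_ * _) (2 ^ d) H]
          exact mul_le_mul_of_nonneg_left (Real.exp_le_exp.mpr (mul_le_mul_of_nonneg_right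
            (rate_le d ha₂ hlam hp.le hb) hG.T_pos.le)) (by positivity)
        · exact hsum hI
    _ = ENNReal.ofReal (A * Real.exp (b * G.T) * B / g * Real.exp (R * G.T))
        * ENNReal.ofReal g * ENNReal.ofReal H := by
        rw [← ENNReal.ofReal_mul (by positivity), ← ENNReal.ofReal_mul (by positivity),
          ← ENNReal.ofReal_mul (by positivity)]
        congr 1
        field_simp
    _ ≤ _ := by
        rw [momentConst]
        gcongr

lemma moment_mono {d m : ℕ} {Ω : Type u} [MeasurableSpace Ω] (P : Measure Ω) (I : Inputs m Ω)
    (S : Model d m) (G : Grid) (x : Fin d → ℝ) {f g : (Fin d → ℝ) → ℝ} (hfg : ∀ y, |f y| ≤ g y)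
    {p : ℝ} (hp : 0 ≤ p) : moment P I S G x f p ≤ moment P I S G x g p := by
  refine lintegral_mono fun ω => ENNReal.ofReal_le_ofReal ?_
  refine Real.rpow_le_rpow (abs_nonneg _) ?_ hp
  rw [abs_mul, abs_mul, abs_mul, abs_mul]
  exact mul_le_mul_of_nonneg_right (mul_le_mul_of_nonneg_left ((hfg _).trans (le_abs_self _))
    (abs_nonneg _)) (abs_nonneg _)

lemma prod_cosh_le_exp_l1norm {d : ℕ} {c : ℝ} (hc : 0 ≤ c) (x : Fin d → ℝ) :
    ∏ i, Real.cosh (c * x i) ≤ Real.exp (c * l1norm x) := by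
  rw [l1norm, Finset.mul_sum, Real.exp_sum]
  refine Finset.prod_le_prod (fun i _ => (Real.cosh_pos _).le) fun i _ => ?_
  rw [← Real.cosh_abs, abs_mul, abs_of_nonneg hc, Real.cosh_eq]
  have h : Real.exp (-(c * |x i|)) ≤ Real.exp (c * |x i|) :=
    Real.exp_le_exp.mpr (by have := mul_nonneg hc (abs_nonneg (x i)); linarith)
  linarith

end Parametrix

end

open Parametrix in
theorem lemma1 {d m : ℕ} (hd : 1 ≤ d) (hm : 1 ≤ m) (S : Model d m) (a₁ a₂ lam₁ lam₂ : ℝ)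
    (hS : S.IsAdmissible a₁ a₂ lam₁ lam₂) (G : Grid) (hG : G.IsValid) :
    (∀ p : ℝ, 0 < p → ∀ c₂ : ℝ, 0 < c₂ → ∃ C : ℝ, 0 < C ∧ ∀ c₁ : ℝ, 0 < c₁ →
      ∀ (x : Fin d → ℝ) (Ω : Type u) [MeasurableSpace Ω] (P : Measure Ω) [IsProbabilityMeasure P]
        (I : Inputs m Ω), I.HasStandardLaw G P →
        moment P I S G x (fun y => Real.exp (c₁ * l1norm y + c₂)) p
          ≤ momentConst S G a₂ lam₂ C c₁ p * ENNReal.ofReal (∏ i, Real.cosh (c₁ * p * x i)))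
    ∧ (∀ p C c₁ : ℝ, 0 < p → p * (1 / 2 - G.γ) < 1 - G.γ →
        momentConst S G a₂ lam₂ C c₁ p < ⊤)
    ∧ (2 * (1 / 2 - G.γ) < 1 - G.γ →
        ∀ (c₁ c₂ : ℝ), 0 < c₁ → 0 < c₂ → ∀ f : (Fin d → ℝ) → ℝ, Measurable f →
        (∀ y, |f y| ≤ Real.exp (c₁ * l1norm y + c₂)) →
        ∃ MT : ℝ, ∀ (x : Fin d → ℝ) (Ω : Type u) [MeasurableSpace Ω] (P : Measure Ω)
          [IsProbabilityMeasure P] (I : Inputs m Ω), I.HasStandardLaw G P →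
          moment P I S G x f 2 < ENNReal.ofReal (MT * Real.exp (2 * c₁ * l1norm x))) := by
  refine ⟨fun p hp c₂ _ => hS.exists_moment_le hG hp c₂, fun p C c₁ _ hpγ =>
    hG.momentConst_lt_top S a₂ lam₂ C c₁ (sub_pos.mpr hpγ), fun hγ c₁ c₂ hc₁ _ f _ hf => ?_⟩
  obtain ⟨C, -, hC⟩ := hS.exists_moment_le hG two_pos c₂
  set M := momentConst S G a₂ lam₂ C c₁ 2
  have hM : M ≠ ⊤ := (hG.momentConst_lt_top S a₂ lam₂ C c₁ (sub_pos.mpr hγ)).ne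
  -- The summand 1 makes the final inequality strict.
  refine ⟨M.toReal + 1, fun x Ω _ P _ I hI => ?_⟩
  calc moment P I S G x f 2
      ≤ moment P I S G x (fun y => Real.exp (c₁ * l1norm y + c₂)) 2 :=
        moment_mono P I S G x hf two_pos.le
    _ ≤ M * ENNReal.ofReal (∏ i, Real.cosh (c₁ * 2 * x i)) := hC c₁ hc₁ x Ω P I hI
    _ ≤ M * ENNReal.ofReal (Real.exp (2 * c₁ * l1norm x)) := by
        gcongr
        rw [mul_comm c₁ 2]
        exact prod_cosh_le_exp_l1norm (by positivity) x
    _ = ENNReal.ofReal (M.toReal * Real.exp (2 * c₁ * l1norm x)) := by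
        rw [ENNReal.ofReal_mul ENNReal.toReal_nonneg, ENNReal.ofReal_toReal hM]
    _ < _ := by
        have h := ENNReal.toReal_nonneg (a := M)
        rw [ENNReal.ofReal_lt_ofReal_iff (by positivity)]
        gcongr
        linarith
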